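/- Conventions. $\|\cdot\|$ is the trace norm (the sum of the singular values). States are positive semidefinite operators of trace one on finite-dimensional systems $ABA'B'$, where Alice holds $A,A'$, Bob holds $B,B'$, and $A,B$ are qubits (the key part). A state is PPT if its partial transpose with respect to $BB'$ is positive semidefinite. A private bit (pbit) is a state of the form $$\gamma=\tfrac12\sum_{i,j=0}^{1}|ii\rangle\langle jj|_{AB}\otimes U_i\,\sigma_{A'B'}\,U_j^\dagger ,$$ where $\sigma$ is a state and $U_0,U_1$ are unitaries on $A'B'$, and $|0\rangle,|1\rangle$ is the standard basis of each qubit. The family. For integers $d\ge2$, $k\ge1$ let $V$ be the swap on $\mathbb C^d\otimes\mathbb C^d$, $\rho_s=\frac{2}{d^2+d}\cdot\frac{I+V}{2}$ and $\rho_a=\frac{2}{d^2-d}\cdot\frac{I-V}{2}$ the symmetric and antisymmetric Werner states, $\tau_1=\left(\frac{\rho_s+\rho_a}{2}\right)^{\otimes k}$, $\tau_2=\rho_s^{\otimes k}$, and, for $0<p\le\frac12$, in blocks with respect to the basis $|00\rangle,|01\rangle,|10\rangle,|11\rangle$ of $AB$, $$\rho_{(p,d,k)}=\begin{pmatrix}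 p\frac{\tau_1+\tau_2}{2}&0&0&p\frac{\tau_1-\tau_2}{2}\\0&(\frac12-p)\tau_2&0&0\\0&0&(\frac12-p)\tau_2&0\\p\frac{\tau_1-\tau_2}{2}&0&0&p\frac{\tau_1+\tau_2}{2}\end{pmatrix}.$$ The recurrence protocol on $m\ge1$ copies of a state $\rho$ takes the first copy as source and performs $m-1$ steps. In each step a fresh copy of $\rho$ is the target; Alice applies a CNOT from her key qubit of the source to her key qubit of the target, and Bob does the same with his; both measure their key qubits of the target in the computational basis; if the outcomes agree they discard the two measured qubits, keep everything else as the new source (the shields accumulate) and continue, and otherwise they abort. Let $\rho^{rec}_{(p,d,k),m}$ be the normalized state conditioned on the success of all $m-1$ steps, for $\rho=\rho_{(p,d,k)}$. Theorem. (1) For every $p\in(\frac14,\frac13]$ and every $\varepsilon>0$ there are $d\ge2$, $k\ge1$ and $m\ge1$ such that $\rho_{(p,d,k)}$ is a PPT state, the recurrence protocol on $m$ copies of it succeeds with nonzero probability, $\rho^{rec}_{(p,d,k),m}$ is a PPT state, and $\|\rho^{rec}_{(p,d,k),m}-\gamma\|\le\varepsilon$ for some private bit $\gamma$. In particular, PPT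 states can be arbitrarily close to pbits in trace norm. (2) For every $p\in(\frac14,\frac12]$ and every $\varepsilon>0$ there are $d\ge2$, $k\ge1$ and $m\ge1$ such that $\rho_{(p,d,k)}$ is a state, the recurrence protocol on $m$ copies of it succeeds with nonzero probability, and the resulting state satisfies $\|\rho^{rec}_{(p,d,k),m}-\gamma\|\le\varepsilon$ for some private bit $\gamma$. (3) For all $p\in(0,\frac12]$, $d\ge2$, $k\ge1$, $m\ge1$, the operator $\rho_{(p,d,k)}$ is a state, the recurrence protocol on $m$ copies of it succeeds with nonzero probability, $\rho^{rec}_{(p,d,k),m}$ is a state, and its upper-right block $A_{0011}$ (the coefficient of $|00\rangle\langle11|_{AB}$) satisfies $$\|A_{0011}\|=\frac12\left(1-\frac1{2^k}\right)^m\frac{1}{1+\left(\frac{1-2p}{2p}\right)^m}.$$ -/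

import Mathlib

open scoped Kronecker ComplexOrder

noncomputable section

/-! ## States, trace norm, partial transposition -/

/-- The trace norm of a complex matrix: the sum of its singular values, i.e. of the square roots of
the eigenvalues of `Aᴴ * A` counted with multiplicity. -/
def traceNorm {ι : Type*} [Fintype ι] [DecidableEq ι] (A : Matrix ι ι ℂ) : ℝ :=
  ∑ i, √((Matrix.isHermitian_conjTranspose_mul_self A).eigenvalues i)

/-- Quantum states: positive semidefinite operators of trace one. -/
def IsState {ι : Type*} [Fintype ι] (ρ : Matrix ι ι ℂ) : Prop :=
  ρ.PosSemidef ∧ ρ.trace = 1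

/-- Operators on `A ⊗ B ⊗ A' ⊗ B'`, in the standard product basis `((a, b), (x, y))`: the key part
is `A ⊗ B` with `A` and `B` of dimension `n`, the shield is `A' ⊗ B'`, where `A'` has basis `α`
(with Alice) and `B'` has basis `β` (with Bob). -/
abbrev KeyShieldOp (n : ℕ) (α β : Type*) : Type _ :=
  Matrix ((Fin n × Fin n) × (α × β)) ((Fin n × Fin n) × (α × β)) ℂ

/-- Partial transposition of all of Bob's systems `B` and `B'`. -/
def partialTransposeBob {n : ℕ} {α β : Type*} (M : KeyShieldOp n α β) : KeyShieldOp n α β :=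
  Matrix.of fun s t => M ((s.1.1, t.1.2), (s.2.1, t.2.2)) ((t.1.1, s.1.2), (t.2.1, s.2.2))

/-- PPT states with respect to the cut `AA' : BB'`. -/
def IsPPTState {n : ℕ} {α β : Type*} [Fintype α] [Fintype β] (ρ : KeyShieldOp n α β) : Prop :=
  IsState ρ ∧ (partialTransposeBob ρ).PosSemidef

/-- The block `A_{ijkl}` of `∑ |ij⟩⟨kl| ⊗ A_{ijkl}`, where `u = (i, j)` and `v = (k, l)`. -/
def block {n : ℕ} {α β : Type*} (M : KeyShieldOp n α β) (u v : Fin n × Fin n) :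
    Matrix (α × β) (α × β) ℂ :=
  Matrix.of fun s t => M (u, s) (v, t)

/-! ## Private states -/

/-- `γ` is a private state whose key basis is `{e i ⊗ f j}`:
`γ = (1/n) ∑ i j, |e i, f i⟩⟨e j, f j| ⊗ U i * σ * (U j)ᴴ` for some state `σ` of the shield and some
unitaries `U i` of the shield. -/
def IsPrivateState {n : ℕ} {α β : Type*} [Fintype α] [Fintype β] [DecidableEq α] [DecidableEq β]
    (e f : OrthonormalBasis (Fin n) ℂ (EuclideanSpace ℂ (Fin n))) (γ : KeyShieldOp n α β) : Prop :=
  ∃ (σ : Matrix (α × β) (α × β) ℂ) (U : Fin n → Matrix.unitaryGroup (α × β) ℂ),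
    IsState σ ∧
    γ = (1 / n : ℂ) • ∑ i, ∑ j,
      (Matrix.of fun u v : Fin n × Fin n =>
        (e i u.1 * f i u.2) * star (e j v.1 * f j v.2)) ⊗ₖ
      ((U i : Matrix (α × β) (α × β) ℂ) * σ * (U j : Matrix (α × β) (α × β) ℂ).conjTranspose)

/-- Private bits, in the form where both local key bases are the standard basis of the qubit
(a special case of allowing arbitrary local orthonormal key bases). -/
def IsPrivateBit {α β : Type*} [Fintype α] [Fintype β] [DecidableEq α] [DecidableEq β]
    (γ : KeyShieldOp 2 α β) : Prop :=
  IsPrivateState (EuclideanSpace.basisFun (Fin 2) ℂ) (EuclideanSpace.basisFun (Fin 2) ℂ) γ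

/-! ## Werner states, hiding states, and the family `ρ_(p,d,k)` -/

/-- The swap operator on `ℂ^d ⊗ ℂ^d`. -/
def swapOp (d : ℕ) : Matrix (Fin d × Fin d) (Fin d × Fin d) ℂ :=
  Matrix.of fun x y => if x = y.swap then 1 else 0

/-- The projector onto the symmetric subspace. -/
def projSym (d : ℕ) : Matrix (Fin d × Fin d) (Fin d × Fin d) ℂ :=
  (1 / 2 : ℂ) • (1 + swapOp d)

/-- The projector onto the antisymmetric subspace. -/
def projAsym (d : ℕ) : Matrix (Fin d × Fin d) (Fin d × Fin d) ℂ :=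
  (1 / 2 : ℂ) • (1 - swapOp d)

/-- The symmetric Werner state. -/
def wernerSym (d : ℕ) : Matrix (Fin d × Fin d) (Fin d × Fin d) ℂ :=
  (2 / ((d : ℂ) ^ 2 + d)) • projSym d

/-- The antisymmetric Werner state (a state for `2 ≤ d`). -/
def wernerAsym (d : ℕ) : Matrix (Fin d × Fin d) (Fin d × Fin d) ℂ :=
  (2 / ((d : ℂ) ^ 2 - d)) • projAsym d

/-- The tensor power `M^{⊗ k}` of a bipartite operator, with the `k` systems of Alice grouped
together and the `k` systems of Bob grouped together. -/
def tensorPow {α β : Type*} (k : ℕ) (M : Matrix (α × β) (α × β) ℂ) :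
    Matrix ((Fin k → α) × (Fin k → β)) ((Fin k → α) × (Fin k → β)) ℂ :=
  Matrix.of fun x y => ∏ l, M (x.1 l, x.2 l) (y.1 l, y.2 l)

/-- The hiding state `τ₁ = ((ρ_s + ρ_a) / 2)^{⊗ k}`. -/
def hiding₁ (d k : ℕ) :
    Matrix ((Fin k → Fin d) × (Fin k → Fin d)) ((Fin k → Fin d) × (Fin k → Fin d)) ℂ :=
  tensorPow k ((1 / 2 : ℂ) • (wernerSym d + wernerAsym d))

/-- The hiding state `τ₂ = ρ_s^{⊗ k}`. -/
def hiding₂ (d k : ℕ) :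
    Matrix ((Fin k → Fin d) × (Fin k → Fin d)) ((Fin k → Fin d) × (Fin k → Fin d)) ℂ :=
  tensorPow k (wernerSym d)

/-- The matrix unit `|u⟩⟨v|` of two qubits. -/
def ketBra (u v : Fin 2 × Fin 2) : Matrix (Fin 2 × Fin 2) (Fin 2 × Fin 2) ℂ :=
  Matrix.single u v 1

/-- The operator `ρ_(p,d,k)`. Its blocks are `p (τ₁ + τ₂) / 2` at `|00⟩⟨00|` and `|11⟩⟨11|`,
`p (τ₁ - τ₂) / 2` at `|00⟩⟨11|` and `|11⟩⟨00|`, and `(1/2 - p) τ₂` at `|01⟩⟨01|` and `|10⟩⟨10|`. -/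
def rhoFamily (p : ℝ) (d k : ℕ) : KeyShieldOp 2 (Fin k → Fin d) (Fin k → Fin d) :=
  (ketBra (0, 0) (0, 0) + ketBra (1, 1) (1, 1)) ⊗ₖ ((p / 2 : ℂ) • (hiding₁ d k + hiding₂ d k)) +
  (ketBra (0, 0) (1, 1) + ketBra (1, 1) (0, 0)) ⊗ₖ ((p / 2 : ℂ) • (hiding₁ d k - hiding₂ d k)) +
  (ketBra (0, 1) (0, 1) + ketBra (1, 0) (1, 0)) ⊗ₖ ((1 / 2 - p : ℂ) • hiding₂ d k)

/-! ## The recurrence protocol -/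

/-- The CNOT gate `|a, t⟩ ↦ |a, a + t⟩` on (source qubit, target qubit). -/
def cnot : Matrix (Fin 2 × Fin 2) (Fin 2 × Fin 2) ℂ :=
  Matrix.of fun x y => if x = (y.1, y.1 + y.2) then 1 else 0

/-- Alice and Bob each apply a CNOT gate, from `A` to the target's `A` and from `B` to the target's
`B`; the shields of the source and of the target are untouched. -/
def bilateralCNOT (S T : Type*) [DecidableEq S] [DecidableEq T] :
    Matrix (((Fin 2 × Fin 2) × S) × ((Fin 2 × Fin 2) × T))
      (((Fin 2 × Fin 2) × S) × ((Fin 2 × Fin 2) × T)) ℂ :=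
  Matrix.of fun x y =>
    cnot (x.1.1.1, x.2.1.1) (y.1.1.1, y.2.1.1) * cnot (x.1.1.2, x.2.1.2) (y.1.1.2, y.2.1.2) *
      ((1 : Matrix S S ℂ) x.1.2 y.1.2 * (1 : Matrix T T ℂ) x.2.2 y.2.2)

/-- The unnormalised state of the remaining systems when, after the bilateral CNOT on the source
`ρ` and the target `τ`, the key qubits of the target have been measured in the computational basis
with outcomes `u` (Alice) and `v` (Bob) and discarded. Its trace is the probability of `(u, v)`. -/
def recurrenceOutcome {α β α' β' : Type*} [Fintype α] [Fintype β] [Fintype α'] [Fintype β']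
    [DecidableEq α] [DecidableEq β] [DecidableEq α'] [DecidableEq β']
    (ρ : KeyShieldOp 2 α β) (τ : KeyShieldOp 2 α' β') (u v : Fin 2) :
    KeyShieldOp 2 (α × α') (β × β') :=
  Matrix.of fun s t =>
    (bilateralCNOT (α × β) (α' × β') * (ρ ⊗ₖ τ) *
        (bilateralCNOT (α × β) (α' × β')).conjTranspose)
      ((s.1, (s.2.1.1, s.2.2.1)), ((u, v), (s.2.1.2, s.2.2.2)))
      ((t.1, (t.2.1.1, t.2.2.1)), ((u, v), (t.2.1.2, t.2.2.2)))

/-- One step of the recurrence protocol, kept if the two outcomes agree (unnormalised). -/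
def recurrenceAgree {α β α' β' : Type*} [Fintype α] [Fintype β] [Fintype α'] [Fintype β']
    [DecidableEq α] [DecidableEq β] [DecidableEq α'] [DecidableEq β']
    (ρ : KeyShieldOp 2 α β) (τ : KeyShieldOp 2 α' β') : KeyShieldOp 2 (α × α') (β × β') :=
  ∑ u : Fin 2, recurrenceOutcome ρ τ u u

/-- The normalised state after `n` successful steps of the recurrence protocol, which starts with
`n + 1` copies of `ρ`: the first is the source, and each step uses one fresh copy as the target.
Alice's shield then consists of `n + 1` copies of her original shield, and so does Bob's. -/
def recurrenceState {α β : Type*} [Fintype α] [Fintype β] [DecidableEq α] [DecidableEq β]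
    (ρ : KeyShieldOp 2 α β) : (n : ℕ) → KeyShieldOp 2 (Fin (n + 1) → α) (Fin (n + 1) → β)
  | 0 => ρ.submatrix (fun s => (s.1, (s.2.1 0, s.2.2 0))) (fun s => (s.1, (s.2.1 0, s.2.2 0)))
  | n + 1 =>
    let split : (Fin 2 × Fin 2) × ((Fin (n + 2) → α) × (Fin (n + 2) → β)) →
        (Fin 2 × Fin 2) × (((Fin (n + 1) → α) × α) × ((Fin (n + 1) → β) × β)) :=
      fun s => (s.1, ((Fin.init s.2.1, s.2.1 (Fin.last (n + 1))),
        (Fin.init s.2.2, s.2.2 (Fin.last (n + 1)))))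
    let M := recurrenceAgree (recurrenceState ρ n) ρ
    M.trace⁻¹ • M.submatrix split split

/-- The probability that the first `n` steps of the recurrence protocol all succeed. -/
def recurrenceProb {α β : Type*} [Fintype α] [Fintype β] [DecidableEq α] [DecidableEq β]
    (ρ : KeyShieldOp 2 α β) (n : ℕ) : ℝ :=
  ∏ i ∈ Finset.range n, (recurrenceAgree (recurrenceState ρ i) ρ).trace.re

end

/-!
Write `ρ_(p,d,k)` in the Bell-type block form `bellBlocks X Y Z` with `X = p (τ₁ + τ₂) / 2`,
`Y = p (τ₁ - τ₂) / 2` and `Z = (1 / 2 - p) τ₂`. An agreeing measurement outcome of a recurrence step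
selects corresponding blocks of the source and of the target and tensors them, so `m` copies end in
`bellBlocks X^{⊗ m} Y^{⊗ m} Z^{⊗ m}` up to the normalisation `2 ((tr X) ^ m + (tr Z) ^ m)`
(`recurrenceState_bellBlocks`). Positivity and the PPT property of such an operator reduce to the
positivity of `X ± Y`, `Z` and of the partial transposes `Z^Γ ± Y^Γ`, `X^Γ`; these conditions pass
to tensor powers (`tensorPow_add_sub_posSemidef`).

The state `τ₁` is the mixture `q θ + (1 - q) τ₂` with `q = 1 - 2⁻ᵏ`, where `θ` lives on the
orthogonal complement of the support of `τ₂`. A reflection `W` in that support therefore satisfies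
`Y = p q W G` for the state `G = (θ + τ₂) / 2`, and `|Y^{⊗ m}| = (p q) ^ m G^{⊗ m}`, which gives the
norm of the off-diagonal block. It also identifies the private bit: with shield `G^{⊗ m}` and
twisting unitary `W^{⊗ m}`, the private bit `γ` has off-diagonal block `W^{⊗ m} G^{⊗ m} / 2`. Since
`X ≥ p q G`, the recurrence state dominates `c γ`, where `c` is twice the norm of its off-diagonal
block, so their trace distance is at most `2 (1 - c)`
(`exists_isPrivateBit_traceNorm_sub_le`). For `1 / 4 < p` the weight `c` tends to `1` when first `m`
and then `k` is taken large.

The dimension `d` is free, and for `p ≤ 1 / 3` the choice `d = 2 k` makes `ρ_(p,d,k)` PPT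
(`rhoFamily_partialTranspose_blocks`).
-/

/-! ### Trace norm -/

section TraceNorm

variable {ι : Type*} [Fintype ι] [DecidableEq ι]

/-- The eigenvalues of the square of a Hermitian matrix are the squares of its eigenvalues, so the
singular values are the absolute values of the eigenvalues. -/
theorem traceNorm_eq_sum_abs_eigenvalues {D : Matrix ι ι ℂ} (hD : D.IsHermitian) :
    traceNorm D = ∑ i, |hD.eigenvalues i| := by
  have hsq : D.conjTranspose * D = cfc (fun x : ℝ => x ^ 2) D := by
    rw [hD.cfc_eq, Matrix.IsHermitian.cfc, hD.eq]
    conv_lhs => rw [hD.spectral_theorem, ← map_mul, Matrix.diagonal_mul_diagonal]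
    congr 2
    funext i
    simp [sq]
  have hroots : Multiset.map (fun i => (((Matrix.isHermitian_conjTranspose_mul_self D).eigenvalues i
      : ℝ) : ℂ)) Finset.univ.val = Multiset.map (fun i => (((hD.eigenvalues i) ^ 2 : ℝ) : ℂ))
        Finset.univ.val := by
    have h1 := (Matrix.isHermitian_conjTranspose_mul_self D).roots_charpoly_eq_eigenvalues
    have h2 : (D.conjTranspose * D).charpoly.roots =
        Multiset.map (fun i => (((hD.eigenvalues i) ^ 2 : ℝ) : ℂ)) Finset.univ.val := by
      rw [hsq, hD.charpoly_cfc_eq]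
      have := Polynomial.roots_multiset_prod_X_sub_C
        (Multiset.map (fun i => (((hD.eigenvalues i) ^ 2 : ℝ) : ℂ)) Finset.univ.val)
      rw [Multiset.map_map] at this
      exact this
    rw [← h2, h1]
    rfl
  have := congrArg (fun s : Multiset ℂ => (s.map fun z => √z.re).sum) hroots
  simp only [Multiset.map_map, Function.comp_def, Complex.ofReal_re, Real.sqrt_sq_eq_abs] at this
  exact this

/-- The trace norm of `A` depends on `Aᴴ * A` only, so it is unchanged when a unitary is removed
from the left of `A`. -/
theorem traceNorm_congr {A B : Matrix ι ι ℂ}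
    (h : A.conjTranspose * A = B.conjTranspose * B) : traceNorm A = traceNorm B := by
  have key : ∀ (M N : Matrix ι ι ℂ) (hM : M.IsHermitian) (hN : N.IsHermitian), M = N →
      ∑ i, √(hM.eigenvalues i) = ∑ i, √(hN.eigenvalues i) := by
    rintro M _ hM hN rfl
    rfl
  exact key _ _ _ _ h

theorem Matrix.PosSemidef.traceNorm_eq {S : Matrix ι ι ℂ} (hS : S.PosSemidef) :
    traceNorm S = S.trace.re := by
  rw [traceNorm_eq_sum_abs_eigenvalues hS.isHermitian, hS.isHermitian.trace_eq_sum_eigenvalues]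
  simp [abs_of_nonneg (hS.eigenvalues_nonneg _)]

/-- The triangle inequality for the trace norm, for a difference of positive operators. -/
theorem traceNorm_sub_le {B C : Matrix ι ι ℂ} (hB : B.PosSemidef) (hC : C.PosSemidef) :
    traceNorm (B - C) ≤ B.trace.re + C.trace.re := by
  have hD : (B - C).IsHermitian := hB.isHermitian.sub hC.isHermitian
  rw [traceNorm_eq_sum_abs_eigenvalues hD]
  -- the trace, computed in an eigenbasis of `B - C`
  have htr : ∀ M : Matrix ι ι ℂ, M.trace.re = ∑ i, (star (hD.eigenvectorBasis i).ofLp ⬝ᵥ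
      M.mulVec (hD.eigenvectorBasis i).ofLp).re := by
    intro M
    have h1 : M.trace = ((hD.eigenvectorUnitary : Matrix ι ι ℂ).conjTranspose * M *
        (hD.eigenvectorUnitary : Matrix ι ι ℂ)).trace := by
      rw [Matrix.trace_mul_comm, ← mul_assoc, ← Matrix.star_eq_conjTranspose,
        Matrix.mem_unitaryGroup_iff.mp hD.eigenvectorUnitary.2, one_mul]
    rw [h1, Matrix.trace, Complex.re_sum]
    refine Finset.sum_congr rfl fun i _ => ?_
    congr 1
    simp only [Matrix.diag, Matrix.mul_assoc]
    simp only [Matrix.mul_apply, dotProduct, Matrix.mulVec, Matrix.conjTranspose_apply,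
      Matrix.IsHermitian.eigenvectorUnitary_apply, Pi.star_apply]
  rw [htr B, htr C, ← Finset.sum_add_distrib]
  refine Finset.sum_le_sum fun i _ => ?_
  have hb := hB.re_dotProduct_nonneg (hD.eigenvectorBasis i).ofLp
  have hc := hC.re_dotProduct_nonneg (hD.eigenvectorBasis i).ofLp
  rw [hD.eigenvalues_eq, Matrix.sub_mulVec, dotProduct_sub]
  simp only [RCLike.re_to_complex, Complex.sub_re] at hb hc ⊢
  rw [abs_le]
  constructor <;> linarith

end TraceNorm

/-! ### Tensor powers -/

theorem Matrix.PosSemidef.of_eq {ι : Type*} {A B : Matrix ι ι ℂ} (hA : A.PosSemidef)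
    (h : B = A) : B.PosSemidef :=
  h ▸ hA

section TensorPower

variable {α β : Type*}

theorem tensorPow_succ (k : ℕ) (M : Matrix (α × β) (α × β) ℂ) :
    tensorPow (k + 1) M = (tensorPow k M ⊗ₖ M).submatrix
      (fun x => ((Fin.init x.1, Fin.init x.2), (x.1 (Fin.last k), x.2 (Fin.last k))))
      (fun x => ((Fin.init x.1, Fin.init x.2), (x.1 (Fin.last k), x.2 (Fin.last k)))) := by
  ext x y
  simp [tensorPow, Fin.prod_univ_castSucc, Fin.init]

theorem tensorPow_smul (k : ℕ) (c : ℂ) (M : Matrix (α × β) (α × β) ℂ) :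
    tensorPow k (c • M) = c ^ k • tensorPow k M := by
  ext x y
  simp [tensorPow, Finset.prod_mul_distrib]

theorem tensorPow_conjTranspose (k : ℕ) (M : Matrix (α × β) (α × β) ℂ) :
    (tensorPow k M).conjTranspose = tensorPow k M.conjTranspose := by
  ext x y
  simp [tensorPow]

theorem tensorPow_one [DecidableEq α] [DecidableEq β] (k : ℕ) :
    tensorPow k (1 : Matrix (α × β) (α × β) ℂ) = 1 := by
  ext x y
  by_cases h : x = y
  · subst h
    simp [tensorPow]
  · rw [Matrix.one_apply_ne h]
    obtain ⟨l, hl⟩ : ∃ l, (x.1 l, x.2 l) ≠ (y.1 l, y.2 l) := by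
      by_contra! hc
      exact h (Prod.ext (funext fun l => congrArg Prod.fst (hc l))
        (funext fun l => congrArg Prod.snd (hc l)))
    exact Finset.prod_eq_zero (Finset.mem_univ l) (Matrix.one_apply_ne hl)

theorem tensorPow_zero [DecidableEq α] [DecidableEq β] (M : Matrix (α × β) (α × β) ℂ) :
    tensorPow 0 M = 1 := by
  ext x y
  simp [tensorPow, Matrix.one_apply, Subsingleton.elim x y]

variable [Fintype α] [Fintype β]

theorem sum_prod_eq_prod_sum (k : ℕ) (f : Fin k → α × β → ℂ) :
    ∑ z : (Fin k → α) × (Fin k → β), ∏ l, f l (z.1 l, z.2 l) = ∏ l, ∑ w, f l w := by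
  classical
  rw [Finset.prod_univ_sum, Fintype.piFinset_univ]
  exact (Fintype.sum_equiv (Equiv.arrowProdEquivProdArrow (Fin k) (fun _ => α) (fun _ => β)) _ _
    fun _ => rfl).symm

theorem tensorPow_mul (k : ℕ) (M N : Matrix (α × β) (α × β) ℂ) :
    tensorPow k (M * N) = tensorPow k M * tensorPow k N := by
  ext x y
  simp only [tensorPow, Matrix.mul_apply, Matrix.of_apply, ← Finset.prod_mul_distrib]
  exact (sum_prod_eq_prod_sum k fun l w => M (x.1 l, x.2 l) w * N w (y.1 l, y.2 l)).symm

theorem trace_tensorPow (k : ℕ) (M : Matrix (α × β) (α × β) ℂ) :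
    (tensorPow k M).trace = M.trace ^ k := by
  simp only [tensorPow, Matrix.trace, Matrix.diag, Matrix.of_apply]
  rw [sum_prod_eq_prod_sum k fun _ w => M w w]
  simp

theorem Matrix.PosSemidef.tensorPow {M : Matrix (α × β) (α × β) ℂ} (hM : M.PosSemidef) (k : ℕ) :
    (tensorPow k M).PosSemidef := by
  induction k with
  | zero =>
    classical
    exact Matrix.PosSemidef.one.of_eq (tensorPow_zero M)
  | succ k ih =>
    rw [tensorPow_succ]
    exact (ih.kronecker hM).submatrix _

/-- Tensor powers are monotone on positive operators, by
`B ⊗ B' - A ⊗ A' = (B - A) ⊗ B' + A ⊗ (B' - A')`. -/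
theorem tensorPow_sub_posSemidef {A B : Matrix (α × β) (α × β) ℂ} (hA : A.PosSemidef)
    (hAB : (B - A).PosSemidef) (k : ℕ) : (tensorPow k B - tensorPow k A).PosSemidef := by
  have hB : B.PosSemidef := by simpa using hAB.add hA
  induction k with
  | zero =>
    classical
    rw [tensorPow_zero, tensorPow_zero, sub_self]
    exact Matrix.PosSemidef.zero
  | succ k ih =>
    have h := ((ih.kronecker hB).add ((hA.tensorPow k).kronecker hAB)).submatrix
      (fun x : (Fin (k + 1) → α) × (Fin (k + 1) → β) =>
        ((Fin.init x.1, Fin.init x.2), (x.1 (Fin.last k), x.2 (Fin.last k))))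
    refine h.of_eq ?_
    rw [tensorPow_succ, tensorPow_succ]
    ext x y
    simp
    ring

/-- If `-X ≤ Y ≤ X`, then all positive tensor powers satisfy the same inequalities, by
`X ⊗ X' ± Y ⊗ Y' = ((X + Y) ⊗ (X' ± Y') + (X - Y) ⊗ (X' ∓ Y')) / 2`. -/
theorem tensorPow_add_sub_posSemidef {X Y : Matrix (α × β) (α × β) ℂ}
    (hadd : (X + Y).PosSemidef) (hsub : (X - Y).PosSemidef) (k : ℕ) :
    (tensorPow (k + 1) X + tensorPow (k + 1) Y).PosSemidef ∧
      (tensorPow (k + 1) X - tensorPow (k + 1) Y).PosSemidef := by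
  have step : ∀ k, (tensorPow k X + tensorPow k Y).PosSemidef ∧
      (tensorPow k X - tensorPow k Y).PosSemidef →
      (tensorPow (k + 1) X + tensorPow (k + 1) Y).PosSemidef ∧
      (tensorPow (k + 1) X - tensorPow (k + 1) Y).PosSemidef := by
    rintro k ⟨h1, h2⟩
    have half : (0 : ℂ) ≤ 1 / 2 := by
      rw [show (1 / 2 : ℂ) = ((1 / 2 : ℝ) : ℂ) by norm_num]
      exact Complex.zero_le_real.mpr (by norm_num)
    constructor
    · refine Matrix.PosSemidef.of_eq
        ((((h1.kronecker hadd).add (h2.kronecker hsub)).smul half).submatrix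
        (fun x : (Fin (k + 1) → α) × (Fin (k + 1) → β) =>
          ((Fin.init x.1, Fin.init x.2), (x.1 (Fin.last k), x.2 (Fin.last k))))) ?_
      rw [tensorPow_succ, tensorPow_succ]
      ext x y
      simp
      ring
    · refine Matrix.PosSemidef.of_eq
        ((((h1.kronecker hsub).add (h2.kronecker hadd)).smul half).submatrix
        (fun x : (Fin (k + 1) → α) × (Fin (k + 1) → β) =>
          ((Fin.init x.1, Fin.init x.2), (x.1 (Fin.last k), x.2 (Fin.last k))))) ?_
      rw [tensorPow_succ, tensorPow_succ]
      ext x y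
      simp
      ring
  induction k with
  | zero =>
    classical
    refine step 0 ?_
    rw [tensorPow_zero, tensorPow_zero, sub_self]
    exact ⟨Matrix.PosSemidef.one.add Matrix.PosSemidef.one, Matrix.PosSemidef.zero⟩
  | succ k ih => exact step _ ih

end TensorPower

/-! ### Operators in Bell-type block form -/

section BellBlocks

variable {α β : Type*}

/-- The operator with blocks `X` at `|00⟩⟨00|` and `|11⟩⟨11|`, `Y` at `|00⟩⟨11|` and `|11⟩⟨00|`, and
`Z` at `|01⟩⟨01|` and `|10⟩⟨10|`; all other blocks vanish. -/
noncomputable def bellBlocks (X Y Z : Matrix (α × β) (α × β) ℂ) : KeyShieldOp 2 α β :=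
  (ketBra (0, 0) (0, 0) + ketBra (1, 1) (1, 1)) ⊗ₖ X +
  (ketBra (0, 0) (1, 1) + ketBra (1, 1) (0, 0)) ⊗ₖ Y +
  (ketBra (0, 1) (0, 1) + ketBra (1, 0) (1, 0)) ⊗ₖ Z

theorem bellBlocks_apply (X Y Z : Matrix (α × β) (α × β) ℂ) (a b c d : Fin 2) (s t : α × β) :
    bellBlocks X Y Z ((a, b), s) ((c, d), t) =
      if a = b then (if c = d then (if a = c then X s t else Y s t) else 0)
      else (if c = a ∧ d = b then Z s t else 0) := by
  fin_cases a <;> fin_cases b <;> fin_cases c <;> fin_cases d <;>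
    simp [bellBlocks, ketBra]

theorem bellBlocks_add (X Y Z X' Y' Z' : Matrix (α × β) (α × β) ℂ) :
    bellBlocks X Y Z + bellBlocks X' Y' Z' = bellBlocks (X + X') (Y + Y') (Z + Z') := by
  simp only [bellBlocks, Matrix.kronecker_add]
  abel

theorem smul_bellBlocks (c : ℂ) (X Y Z : Matrix (α × β) (α × β) ℂ) :
    c • bellBlocks X Y Z = bellBlocks (c • X) (c • Y) (c • Z) := by
  simp only [bellBlocks, Matrix.kronecker_smul, smul_add]

theorem bellBlocks_sub (X Y Z X' Y' Z' : Matrix (α × β) (α × β) ℂ) :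
    bellBlocks X Y Z - bellBlocks X' Y' Z' = bellBlocks (X - X') (Y - Y') (Z - Z') := by
  have h := bellBlocks_add (X - X') (Y - Y') (Z - Z') X' Y' Z'
  simp only [sub_add_cancel] at h
  rw [← h, add_sub_cancel_right]

theorem block_bellBlocks (X Y Z : Matrix (α × β) (α × β) ℂ) :
    block (bellBlocks X Y Z) (0, 0) (1, 1) = Y := by
  ext s t
  simp [block, bellBlocks_apply]

theorem trace_bellBlocks [Fintype α] [Fintype β] (X Y Z : Matrix (α × β) (α × β) ℂ) :
    (bellBlocks X Y Z).trace = 2 * (X.trace + Z.trace) := by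
  simp [Matrix.trace, Fintype.sum_prod_type (α₁ := Fin 2 × Fin 2), Fintype.sum_prod_type
    (α₁ := Fin 2), bellBlocks_apply]
  ring

/-- A Bell-diagonal decomposition: the coefficients of `|00⟩ ± |11⟩` are `(X ± Y) / 2`. -/
theorem bellBlocks_posSemidef [Finite α] [Finite β] {X Y Z : Matrix (α × β) (α × β) ℂ}
    (hadd : (X + Y).PosSemidef) (hsub : (X - Y).PosSemidef) (hZ : Z.PosSemidef) :
    (bellBlocks X Y Z).PosSemidef := by
  have := Fintype.ofFinite α
  have := Fintype.ofFinite β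
  have half : (0 : ℂ) ≤ 1 / 2 := by
    rw [show (1 / 2 : ℂ) = ((1 / 2 : ℝ) : ℂ) by norm_num]
    exact Complex.zero_le_real.mpr (by norm_num)
  let v : Fin 2 × Fin 2 → ℂ := fun a => if a.1 = a.2 then 1 else 0
  let w : Fin 2 × Fin 2 → ℂ := fun a => if a.1 = a.2 then (if a.1 = 0 then 1 else -1) else 0
  let z : Fin 2 × Fin 2 → ℂ := fun a => if a.1 = a.2 then 0 else 1
  have hz : (0 : Fin 2 × Fin 2 → ℂ) ≤ z := by
    intro a
    simp only [z, Pi.zero_apply]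
    split_ifs <;> simp
  refine (((((Matrix.posSemidef_vecMulVec_self_star v).kronecker hadd).smul half).add
    (((Matrix.posSemidef_vecMulVec_self_star w).kronecker hsub).smul half)).add
    ((Matrix.PosSemidef.diagonal hz).kronecker hZ)).of_eq ?_
  ext ⟨⟨a, b⟩, s⟩ ⟨⟨c, d⟩, t⟩
  rw [bellBlocks_apply]
  fin_cases a <;> fin_cases b <;> fin_cases c <;> fin_cases d <;>
    simp [v, w, z, Matrix.vecMulVec_apply] <;> ring

/-- Partial transposition of the shield on Bob's side. -/
def partialTransposeShield (M : Matrix (α × β) (α × β) ℂ) : Matrix (α × β) (α × β) ℂ :=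
  Matrix.of fun s t => M (s.1, t.2) (t.1, s.2)

theorem partialTransposeShield_tensorPow (k : ℕ) (M : Matrix (α × β) (α × β) ℂ) :
    partialTransposeShield (tensorPow k M) = tensorPow k (partialTransposeShield M) :=
  rfl

/-- Partial transposition exchanges the roles of the diagonal blocks: `|00⟩⟨11|` becomes
`|01⟩⟨10|`, so up to a flip of Bob's qubit the blocks `X` and `Z` change places. -/
theorem partialTransposeBob_bellBlocks (X Y Z : Matrix (α × β) (α × β) ℂ) :
    partialTransposeBob (bellBlocks X Y Z) =
      (bellBlocks (partialTransposeShield Z) (partialTransposeShield Y)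
        (partialTransposeShield X)).submatrix
        (fun s => ((s.1.1, s.1.2 + 1), s.2)) (fun s => ((s.1.1, s.1.2 + 1), s.2)) := by
  ext ⟨⟨a, b⟩, s⟩ ⟨⟨c, d⟩, t⟩
  simp only [partialTransposeBob, Matrix.of_apply, Matrix.submatrix_apply, bellBlocks_apply]
  fin_cases a <;> fin_cases b <;> fin_cases c <;> fin_cases d <;>
    simp [partialTransposeShield]

end BellBlocks

/-! ### The recurrence protocol on block form -/

section Recurrence

variable {α β α' β' : Type*} [Fintype α] [Fintype β] [Fintype α'] [Fintype β']
  [DecidableEq α] [DecidableEq β] [DecidableEq α'] [DecidableEq β']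

theorem bilateralCNOT_apply {S T : Type*} [DecidableEq S] [DecidableEq T]
    (x y : ((Fin 2 × Fin 2) × S) × ((Fin 2 × Fin 2) × T)) :
    bilateralCNOT S T x y =
      if y = (x.1, ((x.1.1.1 + x.2.1.1, x.1.1.2 + x.2.1.2), x.2.2)) then 1 else 0 := by
  have key : ∀ a t b u : Fin 2, cnot (a, t) (b, u) = if b = a ∧ u = a + t then 1 else 0 := by
    intro a t b u
    fin_cases a <;> fin_cases t <;> fin_cases b <;> fin_cases u <;> simp [cnot]
  obtain ⟨⟨⟨a, b⟩, s⟩, ⟨⟨c, d⟩, t⟩⟩ := x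
  obtain ⟨⟨⟨a', b'⟩, s'⟩, ⟨⟨c', d'⟩, t'⟩⟩ := y
  simp only [bilateralCNOT, Matrix.of_apply, key, Matrix.one_apply, Prod.mk.injEq]
  simp only [← ite_and, mul_ite, mul_one, mul_zero]
  congr 1
  simp only [eq_iff_iff, eq_comm (a := s), eq_comm (a := t)]
  tauto

/-- The CNOTs permute the product basis, so an outcome `(u, v)` on the target selects the entries
of the target whose key is that of the source shifted by `(u, v)`. -/
theorem recurrenceOutcome_apply (ρ : KeyShieldOp 2 α β) (τ : KeyShieldOp 2 α' β') (u v : Fin 2)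
    (s t : (Fin 2 × Fin 2) × ((α × α') × (β × β'))) :
    recurrenceOutcome ρ τ u v s t =
      ρ (s.1, (s.2.1.1, s.2.2.1)) (t.1, (t.2.1.1, t.2.2.1)) *
      τ ((s.1.1 + u, s.1.2 + v), (s.2.1.2, s.2.2.2))
        ((t.1.1 + u, t.1.2 + v), (t.2.1.2, t.2.2.2)) := by
  simp only [recurrenceOutcome, Matrix.of_apply, Matrix.mul_apply, Matrix.conjTranspose_apply,
    bilateralCNOT_apply]
  simp

theorem recurrenceAgree_bellBlocks (X Y Z : Matrix (α × β) (α × β) ℂ)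
    (X' Y' Z' : Matrix (α' × β') (α' × β') ℂ) :
    recurrenceAgree (bellBlocks X Y Z) (bellBlocks X' Y' Z') =
      Matrix.of fun s t => 2 * bellBlocks (X ⊗ₖ X') (Y ⊗ₖ Y') (Z ⊗ₖ Z')
        (s.1, ((s.2.1.1, s.2.2.1), (s.2.1.2, s.2.2.2)))
        (t.1, ((t.2.1.1, t.2.2.1), (t.2.1.2, t.2.2.2))) := by
  ext ⟨⟨a, b⟩, s⟩ ⟨⟨c, d⟩, t⟩
  simp only [recurrenceAgree, Matrix.sum_apply, recurrenceOutcome_apply, Fin.sum_univ_two,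
    Matrix.of_apply, bellBlocks_apply]
  fin_cases a <;> fin_cases b <;> fin_cases c <;> fin_cases d <;> simp [two_mul]

theorem trace_recurrenceAgree_bellBlocks (X Y Z : Matrix (α × β) (α × β) ℂ)
    (X' Y' Z' : Matrix (α' × β') (α' × β') ℂ) :
    (recurrenceAgree (bellBlocks X Y Z) (bellBlocks X' Y' Z')).trace =
      4 * (X.trace * X'.trace + Z.trace * Z'.trace) := by
  have h : (recurrenceAgree (bellBlocks X Y Z) (bellBlocks X' Y' Z')).trace =
      2 * (bellBlocks (X ⊗ₖ X') (Y ⊗ₖ Y') (Z ⊗ₖ Z')).trace := by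
    rw [recurrenceAgree_bellBlocks, Matrix.trace, Matrix.trace, Finset.mul_sum]
    exact Fintype.sum_equiv ((Equiv.refl _).prodCongr (Equiv.prodProdProdComm α α' β β')) _ _
      fun _ => rfl
  rw [h, trace_bellBlocks, Matrix.trace_kronecker, Matrix.trace_kronecker]
  ring

/-- The recurrence protocol takes tensor powers of the blocks and renormalises. The agreeing
outcomes `00` and `11` contribute equally because `bellBlocks` is invariant under flipping both
qubits. -/
theorem recurrenceState_bellBlocks {X Y Z : Matrix (α × β) (α × β) ℂ}
    (hρ : 2 * (X.trace + Z.trace) = 1)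
    (hN : ∀ m : ℕ, 2 * (X.trace ^ m + Z.trace ^ m) ≠ 0) (n : ℕ) :
    recurrenceState (bellBlocks X Y Z) n =
      (2 * (X.trace ^ (n + 1) + Z.trace ^ (n + 1)))⁻¹ •
        bellBlocks (tensorPow (n + 1) X) (tensorPow (n + 1) Y) (tensorPow (n + 1) Z) := by
  induction n with
  | zero =>
    have h1 : ∀ M : Matrix (α × β) (α × β) ℂ, tensorPow 1 M =
        M.submatrix (fun s => (s.1 0, s.2 0)) (fun s => (s.1 0, s.2 0)) := by
      intro M
      ext s t
      simp [tensorPow]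
    simp only [zero_add, pow_one, hρ, inv_one, one_smul, recurrenceState, h1]
    ext ⟨⟨a, b⟩, s⟩ ⟨⟨c, d⟩, t⟩
    simp only [Matrix.submatrix_apply, bellBlocks_apply]
  | succ n ih =>
    rw [recurrenceState, ih, smul_bellBlocks]
    rw [trace_recurrenceAgree_bellBlocks, recurrenceAgree_bellBlocks]
    have h1 := hN (n + 1)
    have h2 := hN (n + 2)
    set N := 2 * (X.trace ^ (n + 1) + Z.trace ^ (n + 1)) with hNdef
    simp only [Matrix.trace_smul, trace_tensorPow, smul_eq_mul]
    rw [show 4 * (N⁻¹ * X.trace ^ (n + 1) * X.trace + N⁻¹ * Z.trace ^ (n + 1) * Z.trace) =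
      2 * N⁻¹ * (2 * (X.trace ^ (n + 1 + 1) + Z.trace ^ (n + 1 + 1))) by ring, smul_bellBlocks]
    ext ⟨⟨a, b⟩, s⟩ ⟨⟨c, d⟩, t⟩
    simp only [Matrix.smul_apply, Matrix.submatrix_apply, Matrix.of_apply, bellBlocks_apply,
      tensorPow_succ (n + 1), smul_eq_mul, Matrix.kroneckerMap_apply]
    split_ifs <;> field_simp <;> simp

theorem recurrenceProb_bellBlocks_pos {X Y Z : Matrix (α × β) (α × β) ℂ} {x z : ℝ}
    (hX : X.trace = x) (hZ : Z.trace = z) (hx : 0 < x) (hz : 0 ≤ z) (hρ : 2 * (x + z) = 1)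
    (n : ℕ) : 0 < recurrenceProb (bellBlocks X Y Z) n := by
  refine Finset.prod_pos fun i _ => ?_
  have hpos : ∀ m : ℕ, 0 < 2 * (x ^ m + z ^ m) := fun m => by positivity
  have hN : ∀ m : ℕ, 2 * (X.trace ^ m + Z.trace ^ m) ≠ 0 := by
    intro m
    rw [hX, hZ]
    exact_mod_cast (hpos m).ne'
  rw [recurrenceState_bellBlocks (by rw [hX, hZ]; exact_mod_cast hρ) hN, smul_bellBlocks,
    trace_recurrenceAgree_bellBlocks]
  simp only [Matrix.trace_smul, trace_tensorPow, smul_eq_mul, hX, hZ]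
  have h : 0 < 4 * ((2 * (x ^ (i + 1) + z ^ (i + 1)))⁻¹ * x ^ (i + 1) * x +
      (2 * (x ^ (i + 1) + z ^ (i + 1)))⁻¹ * z ^ (i + 1) * z) := by
    have := hpos (i + 1)
    positivity
  refine h.trans_eq ?_
  rw [← Complex.ofReal_re (4 * (_ + _))]
  push_cast
  rfl

end Recurrence

/-! ### Private bits close to recurrence states -/

theorem Matrix.PosSemidef.ofReal_smul {ι : Type*} {A : Matrix ι ι ℂ} (hA : A.PosSemidef) {c : ℝ}
    (hc : 0 ≤ c) : ((c : ℂ) • A).PosSemidef :=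
  hA.smul (Complex.zero_le_real.mpr hc)

theorem partialTransposeBob_smul {α β : Type*} (c : ℂ) (M : KeyShieldOp 2 α β) :
    partialTransposeBob (c • M) = c • partialTransposeBob M :=
  rfl

theorem isState_bellBlocks {α β : Type*} [Fintype α] [Fintype β]
    {X Y Z : Matrix (α × β) (α × β) ℂ} {x z : ℝ}
    (hadd : (X + Y).PosSemidef) (hsub : (X - Y).PosSemidef) (hZ : Z.PosSemidef)
    (hx : X.trace = x) (hz : Z.trace = z) (hρ : 2 * (x + z) = 1) :
    IsState (bellBlocks X Y Z) := by
  refine ⟨bellBlocks_posSemidef hadd hsub hZ, ?_⟩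
  rw [trace_bellBlocks, hx, hz]
  exact_mod_cast hρ

section PrivateBit

variable {α β : Type*} [Fintype α] [Fintype β] [DecidableEq α] [DecidableEq β]

/-- The private bit with `U₀ = 1` and `U₁ = W`, for a Hermitian unitary `W` commuting with `σ`. -/
theorem isPrivateBit_bellBlocks {σ W : Matrix (α × β) (α × β) ℂ} (hσ : IsState σ)
    (hW : W.conjTranspose = W) (hWW : W * W = 1) (hc : σ * W = W * σ) :
    IsPrivateBit ((1 / 2 : ℂ) • bellBlocks σ (W * σ) 0) := by
  refine ⟨σ, ![1, ⟨W, Matrix.mem_unitaryGroup_iff.mpr (by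
    rw [Matrix.star_eq_conjTranspose, hW, hWW])⟩], hσ, ?_⟩
  have h : W * σ * W = σ := by rw [← hc, mul_assoc, hWW, mul_one]
  congr 1
  ext ⟨⟨a, b⟩, s⟩ ⟨⟨c, d⟩, t⟩
  rw [bellBlocks_apply]
  fin_cases a <;> fin_cases b <;> fin_cases c <;> fin_cases d <;>
    simp [Fin.sum_univ_two, hW, h, hc]

end PrivateBit

section RecurrenceLimit

variable {α β : Type*} [Fintype α] [Fintype β] [DecidableEq α] [DecidableEq β]

theorem recurrenceState_bellBlocks_of_ofReal_trace {X Y Z : Matrix (α × β) (α × β) ℂ} {x z : ℝ}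
    (hx : X.trace = x) (hz : Z.trace = z) (hx0 : 0 < x) (hz0 : 0 ≤ z) (hρ : 2 * (x + z) = 1)
    (n : ℕ) :
    recurrenceState (bellBlocks X Y Z) n = (((2 * (x ^ (n + 1) + z ^ (n + 1)))⁻¹ : ℝ) : ℂ) •
      bellBlocks (tensorPow (n + 1) X) (tensorPow (n + 1) Y) (tensorPow (n + 1) Z) := by
  rw [recurrenceState_bellBlocks]
  · rw [hx, hz]
    push_cast
    rfl
  · rw [hx, hz]
    exact_mod_cast hρ
  · intro m
    rw [hx, hz]
    have : 2 * (x ^ m + z ^ m) ≠ 0 := by positivity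
    exact_mod_cast this

theorem isState_recurrenceState_bellBlocks {X Y Z : Matrix (α × β) (α × β) ℂ} {x z : ℝ}
    (hadd : (X + Y).PosSemidef) (hsub : (X - Y).PosSemidef) (hZ : Z.PosSemidef)
    (hx : X.trace = x) (hz : Z.trace = z) (hx0 : 0 < x) (hz0 : 0 ≤ z) (hρ : 2 * (x + z) = 1)
    (n : ℕ) : IsState (recurrenceState (bellBlocks X Y Z) n) := by
  rw [recurrenceState_bellBlocks_of_ofReal_trace hx hz hx0 hz0 hρ]
  have h := tensorPow_add_sub_posSemidef hadd hsub n
  have hN : 0 < 2 * (x ^ (n + 1) + z ^ (n + 1)) := by positivity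
  refine ⟨(bellBlocks_posSemidef h.1 h.2 (hZ.tensorPow _)).ofReal_smul (inv_pos.mpr hN).le, ?_⟩
  rw [Matrix.trace_smul, trace_bellBlocks, trace_tensorPow, trace_tensorPow, hx, hz, smul_eq_mul]
  have := inv_mul_cancel₀ hN.ne'
  exact_mod_cast this

theorem recurrenceState_bellBlocks_partialTranspose_posSemidef
    {X Y Z : Matrix (α × β) (α × β) ℂ} {x z : ℝ}
    (hX : (partialTransposeShield X).PosSemidef)
    (hadd : (partialTransposeShield Z + partialTransposeShield Y).PosSemidef)
    (hsub : (partialTransposeShield Z - partialTransposeShield Y).PosSemidef)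
    (hx : X.trace = x) (hz : Z.trace = z) (hx0 : 0 < x) (hz0 : 0 ≤ z) (hρ : 2 * (x + z) = 1)
    (n : ℕ) : (partialTransposeBob (recurrenceState (bellBlocks X Y Z) n)).PosSemidef := by
  rw [recurrenceState_bellBlocks_of_ofReal_trace hx hz hx0 hz0 hρ]
  have h := tensorPow_add_sub_posSemidef hadd hsub n
  have hN : 0 < 2 * (x ^ (n + 1) + z ^ (n + 1)) := by positivity
  rw [partialTransposeBob_smul, partialTransposeBob_bellBlocks]
  refine Matrix.PosSemidef.ofReal_smul ?_ (inv_pos.mpr hN).le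
  exact (bellBlocks_posSemidef h.1 h.2 (hX.tensorPow _)).submatrix _

/-- If `Y = a W G` for a state `G` and a Hermitian unitary `W` commuting with it, then
`|Y^{⊗ m}| = a ^ m G^{⊗ m}`. -/
theorem traceNorm_block_recurrenceState_bellBlocks {X Z G W : Matrix (α × β) (α × β) ℂ} {x z a : ℝ}
    (hG : IsState G) (hW : W.conjTranspose = W) (hWW : W * W = 1)
    (ha : 0 ≤ a)
    (hx : X.trace = x) (hz : Z.trace = z) (hx0 : 0 < x) (hz0 : 0 ≤ z) (hρ : 2 * (x + z) = 1)
    (n : ℕ) :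
    traceNorm (block (recurrenceState (bellBlocks X ((a : ℂ) • (W * G)) Z) n) (0, 0) (1, 1)) =
      a ^ (n + 1) / (2 * (x ^ (n + 1) + z ^ (n + 1))) := by
  rw [recurrenceState_bellBlocks_of_ofReal_trace hx hz hx0 hz0 hρ, smul_bellBlocks,
    block_bellBlocks, tensorPow_smul, tensorPow_mul, smul_smul]
  set N := 2 * (x ^ (n + 1) + z ^ (n + 1)) with hNdef
  have hN : 0 < N := by positivity
  have hc : 0 ≤ N⁻¹ * a ^ (n + 1) := by positivity
  have hGm := (hG.1.tensorPow (n + 1)).ofReal_smul hc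
  have e : (((N⁻¹ : ℝ) : ℂ) * (a : ℂ) ^ (n + 1)) = ((N⁻¹ * a ^ (n + 1) : ℝ) : ℂ) := by
    push_cast
    rfl
  rw [e]
  have hWm : (tensorPow (n + 1) W).conjTranspose * tensorPow (n + 1) W = 1 := by
    rw [tensorPow_conjTranspose, ← tensorPow_mul, hW, hWW, tensorPow_one]
  rw [traceNorm_congr (B := ((N⁻¹ * a ^ (n + 1) : ℝ) : ℂ) • tensorPow (n + 1) G), hGm.traceNorm_eq,
    Matrix.trace_smul, trace_tensorPow, hG.2, one_pow, smul_eq_mul, mul_one, Complex.ofReal_re]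
  · ring
  · simp only [Matrix.conjTranspose_smul, Matrix.conjTranspose_mul, Matrix.smul_mul,
      Matrix.mul_smul]
    rw [mul_assoc, ← mul_assoc _ (tensorPow (n + 1) W), hWm, one_mul]

/-- The state `ρ` after `n` steps dominates `c γ`, where `γ` is the private bit with shield
`G^{⊗ (n + 1)}` and twisting unitary `W^{⊗ (n + 1)}` and `c` is twice the norm of the off-diagonal
block: `ρ` and `c γ` have the same off-diagonal blocks. Hence `ρ - γ = (ρ - c γ) - (1 - c) γ` is a
difference of two positive operators of trace `1 - c`. -/
theorem exists_isPrivateBit_traceNorm_sub_le {X Z G W : Matrix (α × β) (α × β) ℂ} {x z a : ℝ}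
    (hG : IsState G) (hW : W.conjTranspose = W) (hWW : W * W = 1) (hc : G * W = W * G)
    (ha : 0 ≤ a) (hXG : (X - (a : ℂ) • G).PosSemidef) (hZ : Z.PosSemidef)
    (hx : X.trace = x) (hz : Z.trace = z) (hx0 : 0 < x) (hz0 : 0 ≤ z) (hρ : 2 * (x + z) = 1)
    (n : ℕ) :
    ∃ γ : KeyShieldOp 2 (Fin (n + 1) → α) (Fin (n + 1) → β), IsPrivateBit γ ∧
      traceNorm (recurrenceState (bellBlocks X ((a : ℂ) • (W * G)) Z) n - γ) ≤
        2 * (1 - a ^ (n + 1) / (x ^ (n + 1) + z ^ (n + 1))) := by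
  have hGm : IsState (tensorPow (n + 1) G) :=
    ⟨hG.1.tensorPow _, by rw [trace_tensorPow, hG.2, one_pow]⟩
  have hγ := isPrivateBit_bellBlocks (W := tensorPow (n + 1) W) hGm
    (by rw [tensorPow_conjTranspose, hW]) (by rw [← tensorPow_mul, hWW, tensorPow_one])
    (by rw [← tensorPow_mul, hc, tensorPow_mul])
  refine ⟨_, hγ, ?_⟩
  rw [← tensorPow_mul]
  rw [recurrenceState_bellBlocks_of_ofReal_trace hx hz hx0 hz0 hρ]
  set N := x ^ (n + 1) + z ^ (n + 1) with hNdef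
  have hN : 0 < N := by positivity
  set c := a ^ (n + 1) / N with hcdef
  have hle : a ≤ x := by
    have h := hXG.trace_nonneg
    rw [Matrix.trace_sub, Matrix.trace_smul, hG.2, hx, smul_eq_mul, mul_one, sub_nonneg] at h
    exact_mod_cast h
  have hc1 : c ≤ 1 := by
    rw [hcdef, div_le_one hN]
    have h1 := pow_le_pow_left₀ ha hle (n + 1)
    have h2 := pow_nonneg hz0 (n + 1)
    linarith
  let γ := (1 / 2 : ℂ) • bellBlocks (tensorPow (n + 1) G) (tensorPow (n + 1) (W * G)) 0
  have hB : ((((2 * N)⁻¹ : ℝ) : ℂ) • bellBlocks (tensorPow (n + 1) X - tensorPow (n + 1)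
      ((a : ℂ) • G)) 0 (tensorPow (n + 1) Z)).PosSemidef := by
    have h := tensorPow_sub_posSemidef (hG.1.ofReal_smul ha) hXG (n + 1)
    exact (bellBlocks_posSemidef (by simpa using h) (by simpa using h)
      (hZ.tensorPow _)).ofReal_smul (by positivity)
  have hC : (((1 - c : ℝ) : ℂ) • γ).PosSemidef := by
    have h1 : ((1 / 2 : ℂ)) = ((1 / 2 : ℝ) : ℂ) := by norm_num
    have h2 : (tensorPow (n + 1) G + tensorPow (n + 1) (W * G)).PosSemidef ∧
        (tensorPow (n + 1) G - tensorPow (n + 1) (W * G)).PosSemidef := by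
      -- `(1 ± W) G = (1 ± W) G (1 ± W)ᴴ / 2`, because `W` is a Hermitian unitary commuting with `G`
      have hWGW : W * G * W = G := by rw [← hc, mul_assoc, hWW, mul_one]
      refine tensorPow_add_sub_posSemidef ?_ ?_ n
      · refine ((hG.1.mul_mul_conjTranspose_same (1 + W)).ofReal_smul
          (c := 1 / 2) (by norm_num)).of_eq ?_
        rw [Matrix.conjTranspose_add, hW, Matrix.conjTranspose_one]
        simp only [add_mul, mul_add, one_mul, mul_one, hWGW, hc]
        push_cast
        module
      · refine ((hG.1.mul_mul_conjTranspose_same (1 - W)).ofReal_smul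
          (c := 1 / 2) (by norm_num)).of_eq ?_
        rw [Matrix.conjTranspose_sub, hW, Matrix.conjTranspose_one]
        simp only [sub_mul, mul_sub, one_mul, mul_one, hWGW, hc]
        push_cast
        module
    refine Matrix.PosSemidef.ofReal_smul ?_ (by linarith)
    simp only [γ]
    rw [h1]
    exact (bellBlocks_posSemidef h2.1 h2.2 Matrix.PosSemidef.zero).ofReal_smul (by norm_num)
  have hN' : (N : ℂ) ≠ 0 := by exact_mod_cast hN.ne'
  have hdecomp : (((2 * N)⁻¹ : ℝ) : ℂ) • bellBlocks (tensorPow (n + 1) X)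
      (tensorPow (n + 1) ((a : ℂ) • (W * G))) (tensorPow (n + 1) Z) - γ =
      (((2 * N)⁻¹ : ℝ) : ℂ) • bellBlocks (tensorPow (n + 1) X - tensorPow (n + 1)
      ((a : ℂ) • G)) 0 (tensorPow (n + 1) Z) - ((1 - c : ℝ) : ℂ) • γ := by
    have hac : (((2 * N)⁻¹ : ℝ) : ℂ) * (a : ℂ) ^ (n + 1) = (c : ℂ) * (1 / 2) := by
      rw [hcdef]
      push_cast
      field_simp
    simp only [γ, smul_bellBlocks, bellBlocks_sub, tensorPow_smul, smul_sub, smul_smul, hac]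
    congr 1
    · push_cast
      module
    · push_cast
      module
    · simp
  change traceNorm (_ - γ) ≤ _
  rw [hdecomp]
  refine (traceNorm_sub_le hB hC).trans_eq ?_
  have h1 : ((((2 * N)⁻¹ : ℝ) : ℂ) • bellBlocks (tensorPow (n + 1) X - tensorPow (n + 1)
      ((a : ℂ) • G)) 0 (tensorPow (n + 1) Z)).trace = ((1 - c : ℝ) : ℂ) := by
    rw [Matrix.trace_smul, trace_bellBlocks, Matrix.trace_sub, trace_tensorPow, trace_tensorPow,
      trace_tensorPow, Matrix.trace_smul, hG.2, hx, hz, smul_eq_mul, smul_eq_mul, mul_one,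
      hcdef]
    push_cast
    field_simp
    rw [hNdef]
    push_cast
    ring
  have h2 : (((1 - c : ℝ) : ℂ) • γ).trace = ((1 - c : ℝ) : ℂ) := by
    rw [Matrix.trace_smul, Matrix.trace_smul, trace_bellBlocks, hGm.2]
    simp
  rw [h1, h2, Complex.ofReal_re]
  ring

end RecurrenceLimit

/-! ### Werner states -/

section Werner

variable {d : ℕ}

theorem swapOp_mul_self (d : ℕ) : swapOp d * swapOp d = 1 := by
  ext ⟨a, b⟩ ⟨c, e⟩
  simp only [swapOp, Matrix.mul_apply, Matrix.of_apply, Matrix.one_apply]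
  rw [Finset.sum_eq_single (b, a)]
  · simp [Prod.ext_iff, and_comm]
  · rintro ⟨x, y⟩ - h
    rw [if_neg, zero_mul]
    rintro h'
    simp only [Prod.swap_prod_mk, Prod.mk.injEq] at h'
    exact h (Prod.ext h'.2.symm h'.1.symm)
  · simp

theorem swapOp_conjTranspose (d : ℕ) : (swapOp d).conjTranspose = swapOp d := by
  ext ⟨a, b⟩ ⟨c, e⟩
  simp only [swapOp, Matrix.conjTranspose_apply, Matrix.of_apply, Prod.swap_prod_mk, Prod.mk.injEq]
  rw [apply_ite star, star_one, star_zero]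
  congr 1
  simp only [eq_comm (a := c), eq_comm (a := e), and_comm]

theorem trace_swapOp (d : ℕ) : (swapOp d).trace = d := by
  simp only [swapOp, Matrix.trace, Matrix.diag, Matrix.of_apply, Fintype.sum_prod_type,
    Prod.swap_prod_mk, Prod.mk.injEq]
  have : ∀ a b : Fin d, (a = b ∧ b = a) ↔ a = b := fun a b => ⟨And.left, fun h => ⟨h, h.symm⟩⟩
  simp [this]

theorem projSym_conjTranspose (d : ℕ) : (projSym d).conjTranspose = projSym d := by
  simp [projSym, Matrix.conjTranspose_smul, swapOp_conjTranspose]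

theorem projAsym_conjTranspose (d : ℕ) : (projAsym d).conjTranspose = projAsym d := by
  simp [projAsym, Matrix.conjTranspose_smul, swapOp_conjTranspose]

theorem projSym_mul_projSym (d : ℕ) : projSym d * projSym d = projSym d := by
  simp only [projSym, Matrix.smul_mul, Matrix.mul_smul, add_mul, mul_add, one_mul, mul_one,
    swapOp_mul_self]
  module

theorem projAsym_mul_projAsym (d : ℕ) : projAsym d * projAsym d = projAsym d := by
  simp only [projAsym, Matrix.smul_mul, Matrix.mul_smul, sub_mul, mul_sub, one_mul, mul_one,
    swapOp_mul_self]
  module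

theorem projSym_mul_projAsym (d : ℕ) : projSym d * projAsym d = 0 := by
  simp only [projSym, projAsym, Matrix.smul_mul, Matrix.mul_smul, add_mul, mul_sub, one_mul,
    mul_one, swapOp_mul_self]
  module

theorem projSym_posSemidef (d : ℕ) : (projSym d).PosSemidef :=
  (Matrix.posSemidef_conjTranspose_mul_self (projSym d)).of_eq
    (by rw [projSym_conjTranspose, projSym_mul_projSym])

theorem projAsym_posSemidef (d : ℕ) : (projAsym d).PosSemidef :=
  (Matrix.posSemidef_conjTranspose_mul_self (projAsym d)).of_eq
    (by rw [projAsym_conjTranspose, projAsym_mul_projAsym])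

theorem wernerSym_posSemidef (d : ℕ) : (wernerSym d).PosSemidef := by
  refine ((projSym_posSemidef d).ofReal_smul (c := 2 / ((d : ℝ) ^ 2 + d)) (by positivity)).of_eq ?_
  simp [wernerSym]

theorem wernerAsym_posSemidef (hd : 2 ≤ d) : (wernerAsym d).PosSemidef := by
  have hd' : (2 : ℝ) ≤ d := by exact_mod_cast hd
  refine ((projAsym_posSemidef d).ofReal_smul (c := 2 / ((d : ℝ) ^ 2 - d))
    (div_nonneg (by norm_num) (by nlinarith))).of_eq ?_
  simp [wernerAsym]

theorem natCast_sq_add_ne_zero (hd : 2 ≤ d) : ((d : ℂ) ^ 2 + d) ≠ 0 := by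
  have : (d : ℝ) ^ 2 + d ≠ 0 := by positivity
  exact_mod_cast this

theorem natCast_sq_sub_ne_zero (hd : 2 ≤ d) : ((d : ℂ) ^ 2 - d) ≠ 0 := by
  have hd' : (2 : ℝ) ≤ d := by exact_mod_cast hd
  have : (d : ℝ) ^ 2 - d ≠ 0 := by nlinarith
  exact_mod_cast this

theorem trace_wernerSym (hd : 2 ≤ d) : (wernerSym d).trace = 1 := by
  have := natCast_sq_add_ne_zero hd
  simp [wernerSym, projSym, trace_swapOp]
  field_simp

theorem trace_wernerAsym (hd : 2 ≤ d) : (wernerAsym d).trace = 1 := by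
  have := natCast_sq_sub_ne_zero hd
  simp only [wernerAsym, projAsym, Matrix.trace_smul, Matrix.trace_sub, trace_swapOp,
    Matrix.trace_one, Fintype.card_prod, Fintype.card_fin, Nat.cast_mul, smul_eq_mul]
  rw [← mul_assoc, ← sq, div_mul_div_comm, mul_one, mul_comm _ (2 : ℂ), div_mul_eq_mul_div]
  exact div_eq_one_iff_eq (mul_ne_zero two_ne_zero this) |>.mpr rfl

theorem half_wernerSym_add_wernerAsym_posSemidef (hd : 2 ≤ d) :
    ((1 / 2 : ℂ) • (wernerSym d + wernerAsym d)).PosSemidef :=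
  (((wernerSym_posSemidef d).add (wernerAsym_posSemidef hd)).ofReal_smul (c := 1 / 2)
    (by norm_num)).of_eq (by push_cast; rfl)

end Werner

/-! ### The hiding states -/

section Hiding

variable {d : ℕ}

theorem isState_hiding₁ (hd : 2 ≤ d) (k : ℕ) : IsState (hiding₁ d k) := by
  refine ⟨(half_wernerSym_add_wernerAsym_posSemidef hd).tensorPow k, ?_⟩
  rw [hiding₁, trace_tensorPow, Matrix.trace_smul, Matrix.trace_add, trace_wernerSym hd,
    trace_wernerAsym hd]
  norm_num

theorem isState_hiding₂ (hd : 2 ≤ d) (k : ℕ) : IsState (hiding₂ d k) := by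
  refine ⟨(wernerSym_posSemidef d).tensorPow k, ?_⟩
  rw [hiding₂, trace_tensorPow, trace_wernerSym hd, one_pow]

/-- Expanding the tensor power, `τ₁` contains `τ₂` with weight `2⁻ᵏ`. -/
theorem hiding₁_sub_smul_hiding₂_posSemidef (hd : 2 ≤ d) (k : ℕ) :
    (hiding₁ d k - (1 / 2 : ℂ) ^ k • hiding₂ d k).PosSemidef := by
  rw [hiding₁, hiding₂, ← tensorPow_smul]
  have half : ((1 / 2 : ℝ) : ℂ) = 1 / 2 := by norm_num
  refine tensorPow_sub_posSemidef ?_ ?_ k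
  · rw [← half]
    exact (wernerSym_posSemidef d).ofReal_smul (by norm_num)
  · refine ((wernerAsym_posSemidef hd).ofReal_smul (c := 1 / 2) (by norm_num)).of_eq ?_
    rw [half]
    module

/-- The reflection `1 - 2 Q`, where `Q` projects onto the `k`-th tensor power of the symmetric
subspace, the support of `τ₂`. It tells `τ₂` from the rest of `τ₁`. -/
noncomputable def hidingReflection (d k : ℕ) :
    Matrix ((Fin k → Fin d) × (Fin k → Fin d)) ((Fin k → Fin d) × (Fin k → Fin d)) ℂ :=
  1 - (2 : ℂ) • tensorPow k (projSym d)

theorem hidingReflection_conjTranspose (d k : ℕ) :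
    (hidingReflection d k).conjTranspose = hidingReflection d k := by
  simp [hidingReflection, Matrix.conjTranspose_smul, tensorPow_conjTranspose,
    projSym_conjTranspose]

theorem hidingReflection_mul_self (d k : ℕ) :
    hidingReflection d k * hidingReflection d k = 1 := by
  simp only [hidingReflection, sub_mul, mul_sub, one_mul, mul_one, Matrix.smul_mul,
    Matrix.mul_smul, ← tensorPow_mul, projSym_mul_projSym]
  module

theorem hidingReflection_mul_hiding₂ (d k : ℕ) :
    hidingReflection d k * hiding₂ d k = -hiding₂ d k := by
  have h : projSym d * wernerSym d = wernerSym d := by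
    rw [wernerSym, Matrix.mul_smul, projSym_mul_projSym]
  simp only [hidingReflection, hiding₂, sub_mul, one_mul, Matrix.smul_mul, ← tensorPow_mul, h]
  module

theorem hidingReflection_mul_hiding₁ (d k : ℕ) :
    hidingReflection d k * hiding₁ d k = hiding₁ d k - (2 * (1 / 2 : ℂ) ^ k) • hiding₂ d k := by
  have h : projSym d * ((1 / 2 : ℂ) • (wernerSym d + wernerAsym d)) =
      (1 / 2 : ℂ) • wernerSym d := by
    rw [wernerSym, wernerAsym, Matrix.mul_smul, mul_add, Matrix.mul_smul, Matrix.mul_smul,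
      projSym_mul_projSym, projSym_mul_projAsym, smul_zero, add_zero]
  simp only [hidingReflection, hiding₁, hiding₂, sub_mul, one_mul, Matrix.smul_mul,
    ← tensorPow_mul, h]
  rw [tensorPow_smul k _ (wernerSym d), smul_smul]

/-- The state `(θ + τ₂) / 2`, where `θ` is the normalisation of `τ₁ - 2⁻ᵏ τ₂`. -/
noncomputable def hidingMixture (d k : ℕ) :
    Matrix ((Fin k → Fin d) × (Fin k → Fin d)) ((Fin k → Fin d) × (Fin k → Fin d)) ℂ :=
  (1 / 2 : ℂ) • ((1 - (1 / 2 : ℂ) ^ k)⁻¹ • (hiding₁ d k - (1 / 2 : ℂ) ^ k • hiding₂ d k) +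
    hiding₂ d k)

theorem one_sub_half_pow_pos {k : ℕ} (hk : 1 ≤ k) : 0 < 1 - (1 / 2 : ℝ) ^ k :=
  sub_pos.mpr (pow_lt_one₀ (by norm_num) (by norm_num) (by omega))

theorem one_sub_half_pow_ne_zero {k : ℕ} (hk : 1 ≤ k) : 1 - (1 / 2 : ℂ) ^ k ≠ 0 := by
  have h : (((1 - (1 / 2 : ℝ) ^ k : ℝ)) : ℂ) ≠ 0 := by
    exact_mod_cast (one_sub_half_pow_pos hk).ne'
  simpa using h

theorem isState_hidingMixture (hd : 2 ≤ d) {k : ℕ} (hk : 1 ≤ k) :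
    IsState (hidingMixture d k) := by
  constructor
  · refine ((((hiding₁_sub_smul_hiding₂_posSemidef hd k).ofReal_smul
      (inv_pos.mpr (one_sub_half_pow_pos hk)).le).add (isState_hiding₂ hd k).1).ofReal_smul
      (c := 1 / 2) (by norm_num)).of_eq ?_
    rw [hidingMixture]
    push_cast
    rfl
  · have := one_sub_half_pow_ne_zero hk
    rw [hidingMixture, Matrix.trace_smul, Matrix.trace_add, Matrix.trace_smul, Matrix.trace_sub,
      Matrix.trace_smul, (isState_hiding₁ hd k).2, (isState_hiding₂ hd k).2]
    simp only [smul_eq_mul, mul_one]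
    rw [inv_mul_cancel₀ this]
    norm_num

theorem hidingReflection_mul_hidingMixture {k : ℕ} (hk : 1 ≤ k) :
    (1 - (1 / 2 : ℂ) ^ k) • (hidingReflection d k * hidingMixture d k) =
      (1 / 2 : ℂ) • (hiding₁ d k - hiding₂ d k) := by
  have := one_sub_half_pow_ne_zero hk
  rw [hidingMixture]
  simp only [Matrix.mul_smul, mul_add, mul_sub, hidingReflection_mul_hiding₁,
    hidingReflection_mul_hiding₂]
  set r := (1 / 2 : ℂ) ^ k
  match_scalars <;> field_simp
  ring

theorem hidingMixture_mul_hidingReflection (hd : 2 ≤ d) {k : ℕ} (hk : 1 ≤ k) :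
    hidingMixture d k * hidingReflection d k = hidingReflection d k * hidingMixture d k := by
  have hne := one_sub_half_pow_ne_zero hk
  have h : (hidingReflection d k * hidingMixture d k).conjTranspose =
      hidingReflection d k * hidingMixture d k := by
    have e : hidingReflection d k * hidingMixture d k =
        (((1 - (1 / 2 : ℝ) ^ k)⁻¹ * (1 / 2) : ℝ) : ℂ) • (hiding₁ d k - hiding₂ d k) := by
      have := congrArg (fun M => (1 - (1 / 2 : ℂ) ^ k)⁻¹ • M)
        (hidingReflection_mul_hidingMixture (d := d) hk)
      simp only [smul_smul, inv_mul_cancel₀ hne, one_smul] at this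
      rw [this]
      push_cast
      rfl
    rw [e, Matrix.conjTranspose_smul, Matrix.conjTranspose_sub,
      (isState_hiding₁ hd k).1.isHermitian.eq, (isState_hiding₂ hd k).1.isHermitian.eq]
    simp
  rwa [Matrix.conjTranspose_mul, hidingReflection_conjTranspose,
    (isState_hidingMixture hd hk).1.isHermitian.eq] at h

end Hiding

/-! ### Partial transposes of the hiding states -/

section PartialTransposeHiding

variable {d : ℕ}

/-- The partial transpose of the swap: the unnormalised maximally entangled projector
`∑ i j, |ii⟩⟨jj|`. -/
def maxEntangled (d : ℕ) : Matrix (Fin d × Fin d) (Fin d × Fin d) ℂ :=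
  Matrix.of fun s t => if s.1 = s.2 ∧ t.1 = t.2 then 1 else 0

theorem maxEntangled_conjTranspose (d : ℕ) : (maxEntangled d).conjTranspose = maxEntangled d := by
  ext s t
  simp only [maxEntangled, Matrix.conjTranspose_apply, Matrix.of_apply]
  rw [apply_ite star, star_one, star_zero]
  simp only [and_comm]

theorem maxEntangled_mul_self (d : ℕ) :
    maxEntangled d * maxEntangled d = (d : ℂ) • maxEntangled d := by
  ext s t
  simp only [maxEntangled, Matrix.mul_apply, Matrix.of_apply, Matrix.smul_apply, smul_eq_mul,
    Fintype.sum_prod_type]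
  by_cases hs : s.1 = s.2 <;> by_cases ht : t.1 = t.2 <;> simp [hs, ht]

theorem maxEntangled_posSemidef (hd : 2 ≤ d) : (maxEntangled d).PosSemidef := by
  have hd' : (d : ℂ) ≠ 0 := by exact_mod_cast (by omega : d ≠ 0)
  refine ((Matrix.posSemidef_conjTranspose_mul_self (maxEntangled d)).ofReal_smul
    (c := (d : ℝ)⁻¹) (by positivity)).of_eq ?_
  rw [maxEntangled_conjTranspose, maxEntangled_mul_self, smul_smul]
  push_cast
  rw [inv_mul_cancel₀ hd', one_smul]

theorem one_sub_maxEntangled_posSemidef (hd : 2 ≤ d) :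
    (1 - (d : ℂ)⁻¹ • maxEntangled d).PosSemidef := by
  have hd' : (d : ℂ) ≠ 0 := by exact_mod_cast (by omega : d ≠ 0)
  refine (Matrix.posSemidef_conjTranspose_mul_self (1 - (d : ℂ)⁻¹ • maxEntangled d)).of_eq ?_
  rw [Matrix.conjTranspose_sub, Matrix.conjTranspose_smul, maxEntangled_conjTranspose,
    Matrix.conjTranspose_one, star_inv₀, star_natCast]
  simp only [sub_mul, mul_sub, one_mul, mul_one, Matrix.smul_mul, Matrix.mul_smul,
    maxEntangled_mul_self, smul_smul]
  rw [inv_mul_cancel₀ hd', mul_one]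
  module

theorem partialTransposeShield_one :
    partialTransposeShield (1 : Matrix (Fin d × Fin d) (Fin d × Fin d) ℂ) = 1 := by
  ext ⟨a, b⟩ ⟨c, e⟩
  simp only [partialTransposeShield, Matrix.of_apply, Matrix.one_apply, Prod.mk.injEq,
    eq_comm (a := e)]

theorem partialTransposeShield_swapOp : partialTransposeShield (swapOp d) = maxEntangled d := by
  ext ⟨a, b⟩ ⟨c, e⟩
  simp only [partialTransposeShield, swapOp, maxEntangled, Matrix.of_apply, Prod.swap_prod_mk,
    Prod.mk.injEq, eq_comm (a := e)]

theorem partialTransposeShield_wernerSym :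
    partialTransposeShield (wernerSym d) = ((d : ℂ) ^ 2 + d)⁻¹ • (1 + maxEntangled d) := by
  change (2 / ((d : ℂ) ^ 2 + d)) • (1 / 2 : ℂ) •
    (partialTransposeShield 1 + partialTransposeShield (swapOp d)) = _
  rw [partialTransposeShield_one, partialTransposeShield_swapOp, smul_smul]
  congr 1
  ring

theorem partialTransposeShield_wernerAsym :
    partialTransposeShield (wernerAsym d) = ((d : ℂ) ^ 2 - d)⁻¹ • (1 - maxEntangled d) := by
  change (2 / ((d : ℂ) ^ 2 - d)) • (1 / 2 : ℂ) •
    (partialTransposeShield 1 - partialTransposeShield (swapOp d)) = _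
  rw [partialTransposeShield_one, partialTransposeShield_swapOp, smul_smul]
  congr 1
  ring

theorem partialTransposeShield_half_wernerSym_add_wernerAsym (hd : 2 ≤ d) :
    partialTransposeShield ((1 / 2 : ℂ) • (wernerSym d + wernerAsym d)) =
      ((((d : ℝ) ^ 2 - 1)⁻¹ : ℝ) : ℂ) • (1 - (d : ℂ)⁻¹ • maxEntangled d) := by
  change (1 / 2 : ℂ) • (partialTransposeShield (wernerSym d) +
    partialTransposeShield (wernerAsym d)) = _
  rw [partialTransposeShield_wernerSym, partialTransposeShield_wernerAsym]
  have h0 : (d : ℂ) ≠ 0 := by exact_mod_cast (by omega : d ≠ 0)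
  have hd' : (2 : ℝ) ≤ d := by exact_mod_cast hd
  have h1 : (d : ℂ) + 1 ≠ 0 := by exact_mod_cast (by omega : d + 1 ≠ 0)
  have h2 : (d : ℂ) - 1 ≠ 0 := by
    have : (d : ℝ) - 1 ≠ 0 := by linarith
    exact_mod_cast this
  push_cast
  rw [show (d : ℂ) ^ 2 + d = d * (d + 1) by ring, show (d : ℂ) ^ 2 - d = d * (d - 1) by ring,
    show (d : ℂ) ^ 2 - 1 = (d + 1) * (d - 1) by ring]
  match_scalars <;> field_simp <;> ring

theorem partialTransposeShield_hiding₁_posSemidef (hd : 2 ≤ d) (k : ℕ) :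
    (partialTransposeShield (hiding₁ d k)).PosSemidef := by
  have hd' : (2 : ℝ) ≤ d := by exact_mod_cast hd
  rw [hiding₁, partialTransposeShield_tensorPow,
    partialTransposeShield_half_wernerSym_add_wernerAsym hd]
  exact ((one_sub_maxEntangled_posSemidef hd).ofReal_smul
    (inv_nonneg.mpr (by nlinarith))).tensorPow k

theorem partialTransposeShield_hiding₂_posSemidef (hd : 2 ≤ d) (k : ℕ) :
    (partialTransposeShield (hiding₂ d k)).PosSemidef := by
  rw [hiding₂, partialTransposeShield_tensorPow]
  refine Matrix.PosSemidef.tensorPow ?_ k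
  refine ((Matrix.PosSemidef.one.add (maxEntangled_posSemidef hd)).ofReal_smul
    (c := ((d : ℝ) ^ 2 + d)⁻¹) (by positivity)).of_eq ?_
  rw [partialTransposeShield_wernerSym]
  push_cast
  rfl

/-- The tensor power of `(1 - 1 / d) ((ρ_s + ρ_a) / 2)^Γ ≤ ρ_s^Γ`, which holds because both sides
are `(d ^ 2 + d)⁻¹` times the identity plus a multiple of `maxEntangled d`, negative on the left and
positive on the right. -/
theorem partialTransposeShield_hiding₂_sub_posSemidef (hd : 2 ≤ d) (k : ℕ) :
    (partialTransposeShield (hiding₂ d k) -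
      (((1 - (d : ℝ)⁻¹) ^ k : ℝ) : ℂ) • partialTransposeShield (hiding₁ d k)).PosSemidef := by
  have h0 : (d : ℂ) ≠ 0 := by exact_mod_cast (by omega : d ≠ 0)
  have hd' : (2 : ℝ) ≤ d := by exact_mod_cast hd
  have h1 : (d : ℂ) + 1 ≠ 0 := by exact_mod_cast (by omega : d + 1 ≠ 0)
  have h2 : (d : ℂ) - 1 ≠ 0 := by
    have : (d : ℝ) - 1 ≠ 0 := by linarith
    exact_mod_cast this
  have hinv : 0 ≤ 1 - (d : ℝ)⁻¹ := by
    have := inv_le_one_of_one_le₀ (by linarith : (1 : ℝ) ≤ d)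
    linarith
  rw [hiding₁, hiding₂, partialTransposeShield_tensorPow, partialTransposeShield_tensorPow,
    Complex.ofReal_pow, ← tensorPow_smul, partialTransposeShield_half_wernerSym_add_wernerAsym hd,
    partialTransposeShield_wernerSym]
  refine tensorPow_sub_posSemidef ?_ ?_ k
  · exact ((one_sub_maxEntangled_posSemidef hd).ofReal_smul
      (inv_nonneg.mpr (by nlinarith))).ofReal_smul hinv
  · refine ((maxEntangled_posSemidef hd).ofReal_smul (c := ((d : ℝ) ^ 2)⁻¹)
      (by positivity)).of_eq ?_
    push_cast
    rw [show (d : ℂ) ^ 2 + d = d * (d + 1) by ring,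
      show (d : ℂ) ^ 2 - 1 = (d + 1) * (d - 1) by ring]
    match_scalars <;> field_simp <;> ring

end PartialTransposeHiding

/-! ### The family of states -/

section Family

variable {p : ℝ} {d k : ℕ}

theorem rhoFamily_eq_bellBlocks (p : ℝ) (d : ℕ) (hk : 1 ≤ k) :
    rhoFamily p d k = bellBlocks ((p / 2 : ℂ) • (hiding₁ d k + hiding₂ d k))
      (((p * (1 - (1 / 2) ^ k) : ℝ) : ℂ) • (hidingReflection d k * hidingMixture d k))
      ((1 / 2 - p : ℂ) • hiding₂ d k) := by
  have h : ((p * (1 - (1 / 2) ^ k) : ℝ) : ℂ) • (hidingReflection d k * hidingMixture d k) =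
      (p / 2 : ℂ) • (hiding₁ d k - hiding₂ d k) := by
    rw [show ((p * (1 - (1 / 2) ^ k) : ℝ) : ℂ) = (p : ℂ) * (1 - (1 / 2 : ℂ) ^ k) by push_cast; rfl,
      mul_smul, hidingReflection_mul_hidingMixture hk, smul_smul]
    congr 1
    ring
  rw [h]
  rfl

theorem trace_rhoFamily_correlated (hd : 2 ≤ d) :
    ((p / 2 : ℂ) • (hiding₁ d k + hiding₂ d k)).trace = p := by
  rw [Matrix.trace_smul, Matrix.trace_add, (isState_hiding₁ hd k).2, (isState_hiding₂ hd k).2,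
    smul_eq_mul]
  ring

theorem trace_rhoFamily_anticorrelated (hd : 2 ≤ d) :
    ((1 / 2 - p : ℂ) • hiding₂ d k).trace = ((1 / 2 - p : ℝ) : ℂ) := by
  rw [Matrix.trace_smul, (isState_hiding₂ hd k).2, smul_eq_mul]
  push_cast
  ring

theorem rhoFamily_anticorrelated_posSemidef (hp : p ≤ 1 / 2) (hd : 2 ≤ d) :
    ((1 / 2 - p : ℂ) • hiding₂ d k).PosSemidef :=
  ((isState_hiding₂ hd k).1.ofReal_smul (c := 1 / 2 - p) (by linarith)).of_eq (by push_cast; rfl)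

theorem rhoFamily_add_posSemidef (hp0 : 0 < p) (hd : 2 ≤ d) :
    ((p / 2 : ℂ) • (hiding₁ d k + hiding₂ d k) +
      (p / 2 : ℂ) • (hiding₁ d k - hiding₂ d k)).PosSemidef :=
  ((isState_hiding₁ hd k).1.ofReal_smul hp0.le).of_eq (by module)

theorem rhoFamily_sub_posSemidef (hp0 : 0 < p) (hd : 2 ≤ d) :
    ((p / 2 : ℂ) • (hiding₁ d k + hiding₂ d k) -
      (p / 2 : ℂ) • (hiding₁ d k - hiding₂ d k)).PosSemidef :=
  ((isState_hiding₂ hd k).1.ofReal_smul hp0.le).of_eq (by module)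

theorem isState_rhoFamily (hp0 : 0 < p) (hp : p ≤ 1 / 2) (hd : 2 ≤ d) :
    IsState (rhoFamily p d k) :=
  isState_bellBlocks (rhoFamily_add_posSemidef hp0 hd) (rhoFamily_sub_posSemidef hp0 hd)
    (rhoFamily_anticorrelated_posSemidef hp hd) (trace_rhoFamily_correlated hd)
    (trace_rhoFamily_anticorrelated hd) (by ring)

theorem isState_recurrenceState_rhoFamily (hp0 : 0 < p) (hp : p ≤ 1 / 2) (hd : 2 ≤ d) (n : ℕ) :
    IsState (recurrenceState (rhoFamily p d k) n) :=
  isState_recurrenceState_bellBlocks (rhoFamily_add_posSemidef hp0 hd)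
    (rhoFamily_sub_posSemidef hp0 hd) (rhoFamily_anticorrelated_posSemidef hp hd)
    (trace_rhoFamily_correlated hd) (trace_rhoFamily_anticorrelated hd) hp0 (by linarith) (by ring) n

theorem recurrenceProb_rhoFamily_pos (hp0 : 0 < p) (hp : p ≤ 1 / 2) (hd : 2 ≤ d) (n : ℕ) :
    0 < recurrenceProb (rhoFamily p d k) n :=
  recurrenceProb_bellBlocks_pos (trace_rhoFamily_correlated hd)
    (trace_rhoFamily_anticorrelated hd) hp0 (by linarith) (by ring) n

/-- The fraction `c` of a private bit contained in the state after `n` steps: twice the trace norm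
of its off-diagonal block. -/
noncomputable def privateBitWeight (p : ℝ) (k n : ℕ) : ℝ :=
  (1 - 1 / 2 ^ k) ^ (n + 1) / (1 + ((1 - 2 * p) / (2 * p)) ^ (n + 1))

theorem pow_div_eq_privateBitWeight (hp0 : 0 < p) (hp : p ≤ 1 / 2) (k n : ℕ) :
    (p * (1 - (1 / 2) ^ k)) ^ (n + 1) / (p ^ (n + 1) + (1 / 2 - p) ^ (n + 1)) =
      privateBitWeight p k n := by
  have h0 : 0 ≤ 1 / 2 - p := by linarith
  have h1 : (1 - 2 * p) / (2 * p) = (1 / 2 - p) / p := by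
    field_simp
  have h2 : p ^ (n + 1) + (1 / 2 - p) ^ (n + 1) ≠ 0 := by positivity
  rw [privateBitWeight, h1, mul_pow, one_div_pow, div_pow (1 / 2 - p)]
  field_simp

theorem traceNorm_block_recurrenceState_rhoFamily (hp0 : 0 < p) (hp : p ≤ 1 / 2) (hd : 2 ≤ d)
    (hk : 1 ≤ k) (n : ℕ) :
    traceNorm (block (recurrenceState (rhoFamily p d k) n) (0, 0) (1, 1)) =
      1 / 2 * privateBitWeight p k n := by
  rw [rhoFamily_eq_bellBlocks p d hk,
    traceNorm_block_recurrenceState_bellBlocks (isState_hidingMixture hd hk)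
      (hidingReflection_conjTranspose d k) (hidingReflection_mul_self d k)
      (mul_nonneg hp0.le (one_sub_half_pow_pos hk).le)
      (trace_rhoFamily_correlated hd) (trace_rhoFamily_anticorrelated hd) hp0 (by linarith)
      (by ring) n, ← pow_div_eq_privateBitWeight hp0 hp]
  rw [div_mul_div_comm, one_mul]

theorem exists_isPrivateBit_near_recurrenceState_rhoFamily (hp0 : 0 < p) (hp : p ≤ 1 / 2)
    (hd : 2 ≤ d) (hk : 1 ≤ k) (n : ℕ) :
    ∃ γ : KeyShieldOp 2 (Fin (n + 1) → Fin k → Fin d) (Fin (n + 1) → Fin k → Fin d),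
      IsPrivateBit γ ∧ traceNorm (recurrenceState (rhoFamily p d k) n - γ) ≤
        2 * (1 - privateBitWeight p k n) := by
  have hne := one_sub_half_pow_ne_zero hk
  rw [rhoFamily_eq_bellBlocks p d hk, ← pow_div_eq_privateBitWeight hp0 hp]
  refine exists_isPrivateBit_traceNorm_sub_le (isState_hidingMixture hd hk)
    (hidingReflection_conjTranspose d k) (hidingReflection_mul_self d k)
    (hidingMixture_mul_hidingReflection hd hk) (mul_nonneg hp0.le (one_sub_half_pow_pos hk).le)
    ?_ (rhoFamily_anticorrelated_posSemidef hp hd) (trace_rhoFamily_correlated hd)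
    (trace_rhoFamily_anticorrelated hd) hp0 (by linarith) (by ring) n
  refine ((isState_hiding₂ hd k).1.ofReal_smul (c := p * (1 / 2) ^ k) (by positivity)).of_eq ?_
  rw [hidingMixture]
  push_cast
  set r := (1 / 2 : ℂ) ^ k
  match_scalars <;> field_simp <;> ring

/-- For `p ≤ 1 / 3` and `d = 2 k`, the blocks `Z^Γ ± Y^Γ` of the partial transpose are positive:
the worse sign is `(1 - p) τ₂^Γ ≥ p τ₁^Γ` up to a factor `1 / 2`, and
`τ₂^Γ ≥ (1 - 1 / d) ^ k τ₁^Γ ≥ τ₁^Γ / 2` by Bernoulli's inequality. -/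
theorem rhoFamily_partialTranspose_blocks (hp0 : 0 < p) (hp : p ≤ 1 / 3) (hk : 1 ≤ k) :
    (partialTransposeShield ((p / 2 : ℂ) • (hiding₁ (2 * k) k + hiding₂ (2 * k) k))).PosSemidef ∧
    (partialTransposeShield ((1 / 2 - p : ℂ) • hiding₂ (2 * k) k) +
      partialTransposeShield ((p / 2 : ℂ) • (hiding₁ (2 * k) k - hiding₂ (2 * k) k))).PosSemidef ∧
    (partialTransposeShield ((1 / 2 - p : ℂ) • hiding₂ (2 * k) k) -
      partialTransposeShield ((p / 2 : ℂ) •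
        (hiding₁ (2 * k) k - hiding₂ (2 * k) k))).PosSemidef := by
  have hd : 2 ≤ 2 * k := by omega
  have h1 := partialTransposeShield_hiding₁_posSemidef hd k
  have h2 := partialTransposeShield_hiding₂_posSemidef hd k
  have h3 := partialTransposeShield_hiding₂_sub_posSemidef hd k
  set c : ℝ := (1 - ((2 * k : ℕ) : ℝ)⁻¹) ^ k with hc
  have hk' : (1 : ℝ) ≤ k := by exact_mod_cast hk
  have hcle : 1 / 2 ≤ c := by
    have hinv : ((2 * k : ℕ) : ℝ)⁻¹ ≤ 1 := by
      apply inv_le_one_of_one_le₀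
      push_cast
      linarith
    have h := one_add_mul_le_pow (a := -((2 * k : ℕ) : ℝ)⁻¹) (by linarith) k
    rw [← sub_eq_add_neg, ← hc] at h
    refine le_trans (le_of_eq ?_) h
    push_cast
    field_simp
    norm_num
  set T₁ := partialTransposeShield (hiding₁ (2 * k) k)
  set T₂ := partialTransposeShield (hiding₂ (2 * k) k)
  have e1 : partialTransposeShield ((p / 2 : ℂ) • (hiding₁ (2 * k) k + hiding₂ (2 * k) k)) =
    (p / 2 : ℂ) • (T₁ + T₂) := rfl
  have e2 : partialTransposeShield ((p / 2 : ℂ) • (hiding₁ (2 * k) k - hiding₂ (2 * k) k)) =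
    (p / 2 : ℂ) • (T₁ - T₂) := rfl
  have e3 : partialTransposeShield ((1 / 2 - p : ℂ) • hiding₂ (2 * k) k) =
    (1 / 2 - p : ℂ) • T₂ := rfl
  rw [e1, e2, e3]
  refine ⟨((h1.add h2).ofReal_smul (c := p / 2) (by linarith)).of_eq (by push_cast; rfl), ?_, ?_⟩
  · refine ((h2.ofReal_smul (c := 1 / 2 - 3 * p / 2) (by linarith)).add
      (h1.ofReal_smul (c := p / 2) (by linarith))).of_eq ?_
    push_cast
    module
  · refine ((h3.ofReal_smul (c := (1 - p) / 2) (by linarith)).add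
      (h1.ofReal_smul (c := ((1 - p) * c - p) / 2) (by nlinarith))).of_eq ?_
    push_cast
    module

theorem isPPTState_rhoFamily (hp0 : 0 < p) (hp : p ≤ 1 / 3) (hk : 1 ≤ k) :
    IsPPTState (rhoFamily p (2 * k) k) := by
  obtain ⟨h1, h2, h3⟩ := rhoFamily_partialTranspose_blocks hp0 hp hk
  refine ⟨isState_rhoFamily hp0 (by linarith) (by omega), ?_⟩
  change (partialTransposeBob (bellBlocks _ _ _)).PosSemidef
  rw [partialTransposeBob_bellBlocks]
  exact (bellBlocks_posSemidef h2 h3 h1).submatrix _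

theorem isPPTState_recurrenceState_rhoFamily (hp0 : 0 < p) (hp : p ≤ 1 / 3) (hk : 1 ≤ k) (n : ℕ) :
    IsPPTState (recurrenceState (rhoFamily p (2 * k) k) n) := by
  have hd : 2 ≤ 2 * k := by omega
  obtain ⟨h1, h2, h3⟩ := rhoFamily_partialTranspose_blocks hp0 hp hk
  exact ⟨isState_recurrenceState_rhoFamily hp0 (by linarith) hd n,
    recurrenceState_bellBlocks_partialTranspose_posSemidef h1 h2 h3 (trace_rhoFamily_correlated hd)
      (trace_rhoFamily_anticorrelated hd) hp0 (by linarith) (by ring) n⟩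

/-- For `1 / 4 < p` the ratio `(1 - 2 p) / (2 p)` is below `1`, so many steps remove the
anticorrelated blocks; after fixing their number, a large `k` makes the shields distinguishable. -/
theorem exists_privateBitWeight_gt (hp4 : 1 / 4 < p) (hp : p ≤ 1 / 2) {c : ℝ} (hc : c < 1) :
    ∃ k n : ℕ, 1 ≤ k ∧ c < privateBitWeight p k n := by
  have hx0 : 0 ≤ (1 - 2 * p) / (2 * p) := div_nonneg (by linarith) (by linarith)
  have hx1 : (1 - 2 * p) / (2 * p) < 1 := by
    rw [div_lt_one (by linarith)]
    linarith
  have hn : Filter.Tendsto (fun n : ℕ => 1 / (1 + ((1 - 2 * p) / (2 * p)) ^ (n + 1)))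
      Filter.atTop (nhds (1 / (1 + 0))) :=
    tendsto_const_nhds.div (tendsto_const_nhds.add ((tendsto_pow_atTop_nhds_zero_of_lt_one hx0
      hx1).comp (Filter.tendsto_add_atTop_nat 1))) (by norm_num)
  obtain ⟨n, hn⟩ := (hn.eventually_const_lt (by simpa using hc)).exists
  have hk : Filter.Tendsto (fun k : ℕ => privateBitWeight p k n) Filter.atTop
      (nhds ((1 - 0) ^ (n + 1) / (1 + ((1 - 2 * p) / (2 * p)) ^ (n + 1)))) := by
    refine Filter.Tendsto.div_const ((tendsto_const_nhds.sub ?_).pow _) _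
    simpa only [one_div_pow] using
      tendsto_pow_atTop_nhds_zero_of_lt_one (r := (1 / 2 : ℝ)) (by norm_num) (by norm_num)
  obtain ⟨k, hk, hk1⟩ := ((hk.eventually_const_lt (by simpa using hn)).and
    (Filter.eventually_ge_atTop 1)).exists
  exact ⟨k, n, hk1, hk⟩

end Family

theorem mainTheorem4 :
    -- PPT states obtained by recurrence come arbitrarily close to private bits
    (∀ p : ℝ, 1 / 4 < p → p ≤ 1 / 3 → ∀ ε : ℝ, 0 < ε →
      ∃ d k n : ℕ, 2 ≤ d ∧ 1 ≤ k ∧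
        IsPPTState (rhoFamily p d k) ∧
        0 < recurrenceProb (rhoFamily p d k) n ∧
        IsPPTState (recurrenceState (rhoFamily p d k) n) ∧
        ∃ γ : KeyShieldOp 2 (Fin (n + 1) → Fin k → Fin d) (Fin (n + 1) → Fin k → Fin d),
          IsPrivateBit γ ∧
          traceNorm (recurrenceState (rhoFamily p d k) n - γ) ≤ ε) ∧
    -- without the PPT property, this holds for every `p` above `1 / 4` in the family
    (∀ p : ℝ, 1 / 4 < p → p ≤ 1 / 2 → ∀ ε : ℝ, 0 < ε →
      ∃ d k n : ℕ, 2 ≤ d ∧ 1 ≤ k ∧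
        IsState (rhoFamily p d k) ∧
        0 < recurrenceProb (rhoFamily p d k) n ∧
        IsState (recurrenceState (rhoFamily p d k) n) ∧
        ∃ γ : KeyShieldOp 2 (Fin (n + 1) → Fin k → Fin d) (Fin (n + 1) → Fin k → Fin d),
          IsPrivateBit γ ∧
          traceNorm (recurrenceState (rhoFamily p d k) n - γ) ≤ ε) ∧
    -- the upper-right block after `n` steps, that is, with `m = n + 1` copies
    (∀ p : ℝ, 0 < p → p ≤ 1 / 2 → ∀ d k n : ℕ, 2 ≤ d → 1 ≤ k →
      IsState (rhoFamily p d k) ∧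
      0 < recurrenceProb (rhoFamily p d k) n ∧
      IsState (recurrenceState (rhoFamily p d k) n) ∧
      traceNorm (block (recurrenceState (rhoFamily p d k) n) (0, 0) (1, 1)) =
        1 / 2 * (1 - 1 / 2 ^ k) ^ (n + 1) / (1 + ((1 - 2 * p) / (2 * p)) ^ (n + 1))) := by
  refine ⟨fun p hp4 hp ε hε => ?_, fun p hp4 hp ε hε => ?_, fun p hp0 hp d k n hd hk => ?_⟩
  · obtain ⟨k, n, hk, hkn⟩ := exists_privateBitWeight_gt (c := 1 - ε / 2) hp4 (by linarith)
      (by linarith)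
    have hp0 : 0 < p := by linarith
    have hp2 : p ≤ 1 / 2 := by linarith
    have hd : 2 ≤ 2 * k := by omega
    obtain ⟨γ, hγ, hle⟩ := exists_isPrivateBit_near_recurrenceState_rhoFamily hp0 hp2 hd hk n
    exact ⟨2 * k, k, n, hd, hk, isPPTState_rhoFamily hp0 hp hk,
      recurrenceProb_rhoFamily_pos hp0 hp2 hd n, isPPTState_recurrenceState_rhoFamily hp0 hp hk n,
      γ, hγ, hle.trans (by linarith)⟩
  · obtain ⟨k, n, hk, hkn⟩ := exists_privateBitWeight_gt (c := 1 - ε / 2) hp4 hp (by linarith)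
    have hp0 : 0 < p := by linarith
    obtain ⟨γ, hγ, hle⟩ :=
      exists_isPrivateBit_near_recurrenceState_rhoFamily hp0 hp le_rfl hk n
    exact ⟨2, k, n, le_rfl, hk, isState_rhoFamily hp0 hp le_rfl,
      recurrenceProb_rhoFamily_pos hp0 hp le_rfl n,
      isState_recurrenceState_rhoFamily hp0 hp le_rfl n, γ, hγ, hle.trans (by linarith)⟩
  · refine ⟨isState_rhoFamily hp0 hp hd, recurrenceProb_rhoFamily_pos hp0 hp hd n,
      isState_recurrenceState_rhoFamily hp0 hp hd n, ?_⟩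
    rw [traceNorm_block_recurrenceState_rhoFamily hp0 hp hd hk, privateBitWeight, mul_div_assoc]
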